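/- Let $H$ be a Hadamard matrix of order $n$ (an $n\times n$ matrix with entries $\pm1$ and $HH^{T}=nI$). Its Hadamard graph $G$ has the $4n$ vertices $r_i^{\pm}, c_j^{\pm}$ ($1\le i,j\le n$), where $r_i^{\varepsilon}$ and $c_j^{\delta}$ ($\varepsilon,\delta\in\{1,-1\}$) are adjacent if and only if $H_{ij}=\varepsilon\delta$, and there are no other edges. Let $A$ be the adjacency matrix of $G$, with distinct eigenvalues $\theta_0>\theta_1>\cdots$ (for $n\ge 2$ these are $n,\sqrt n,0,-\sqrt n,-n$), and consider free fermions on the vertices of $G$ with creation operators $c_v^{\dagger}$. For an orthonormal basis $w_1,\dots,w_F$ of the sum of the eigenspaces of $A$ for $\theta_0,\dots,\theta_K$, let $$|\Psi_K\rangle=\tilde c_1^{\dagger}\cdots\tilde c_F^{\dagger}|0\rangle,\qquad \tilde c_i^{\dagger}=\sum_{v}w_i(v)\,c_v^{\dagger},$$ be the state in which exactly these modes are filled (it is independent of the basis up to a phase). Fix a vertex $x$ of $G$, let subsystem $1$ consist of all vertices at distance at most $\ell$ from $x$, let subsystem $2$ be its complement, and let $$\rho_1=\operatorname{tr}_2|\Psi_K\rangle\langle\Psi_K|,\qquad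 S_{K,\ell}=-\operatorname{tr}(\rho_1\ln\rho_1)$$ be the reduced density matrix and its von Neumann entropy. Then, for every sequence of Hadamard matrices whose orders $n$ tend to infinity, and every choice of reference vertices $x$ in their Hadamard graphs, as $n\to\infty$: 1. $S_{2,3}\sim S_{1,3}$, and both converge to $2\ln 2-\tfrac34\ln 3$; 2. $S_{3,3}\sim \dfrac{\ln n}{4n}$; 3. $S_{1,1}\sim S_{1,2}\sim S_{2,2}\sim\left(2\ln 2-\tfrac34\ln 3\right)n$. Here $f\sim g$ means that $f/g\to1$. -/

import Mathlib

open Filter Topology Asymptotics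

noncomputable section

/-! ### Free fermions on a finite graph -/

namespace FreeFermion

variable {V : Type*} [Fintype V] [DecidableEq V]

/-- The fermionic Fock space over the sites `V`, in the occupation basis: `ψ s` is the amplitude of
the configuration in which exactly the sites of `s` are occupied. -/
abbrev Fock (V : Type*) : Type _ := Finset V → ℂ

/-- The vacuum: the configuration without particles, with amplitude one. -/
def vacuum : Fock V := Pi.single ∅ 1

/-- A numbering of the sites in which those of the subsystem `S` come first
(`y` has a smaller number than `z`). -/
def SiteLT (S : Finset V) (y z : V) : Prop :=
  (y ∈ S ∧ z ∉ S) ∨ ((y ∈ S ↔ z ∈ S) ∧ Fintype.equivFin V y < Fintype.equivFin V z)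

open Classical in
/-- The creation operator `c†_y`, with the usual sign `(-1) ^ (number of particles before y)`:
the Fock space is thereby the (graded) tensor product of the Fock spaces of `S` and of its
complement, with `S` as the first factor. -/
def siteCreation (S : Finset V) (y : V) : Module.End ℂ (Fock V) where
  toFun ψ s := if y ∈ s then (-1) ^ (s.filter fun z => SiteLT S z y).card * ψ (s.erase y) else 0
  map_add' ψ φ := by
    funext s
    by_cases h : y ∈ s <;> simp [h, mul_add]
  map_smul' a ψ := by
    funext s
    by_cases h : y ∈ s <;> simp [h, mul_left_comm]

/-- The operator `∑ y, w y • c†_y` that creates a particle in the one-particle state `w`. -/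
def modeCreation (S : Finset V) (w : EuclideanSpace ℂ V) : Module.End ℂ (Fock V) :=
  ∑ y, w y • siteCreation S y

/-- The one-particle Hamiltonian: the adjacency matrix, acting on `ℂ^V`. -/
def hopping (G : SimpleGraph V) [DecidableRel G.Adj] :
    Module.End ℂ (EuclideanSpace ℂ V) :=
  Matrix.toEuclideanLin (G.adjMatrix ℂ)

/-- `μ` is one of `θ_0, …, θ_K`, where `θ_0 > θ_1 > ⋯` are the distinct eigenvalues of the
adjacency matrix: it is an eigenvalue, and at most `K` eigenvalues are larger. -/
def IsFilledLevel (G : SimpleGraph V) [DecidableRel G.Adj] (K : ℕ) (μ : ℝ) : Prop :=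
  (hopping G).HasEigenvalue (μ : ℂ) ∧
    {ν : ℝ | (hopping G).HasEigenvalue (ν : ℂ) ∧ μ < ν}.ncard ≤ K

/-- The space of the filled one-particle states: the sum of the eigenspaces of `θ_0, …, θ_K`. -/
def filledModes (G : SimpleGraph V) [DecidableRel G.Adj] (K : ℕ) :
    Submodule ℂ (EuclideanSpace ℂ V) :=
  ⨆ (μ : ℝ) (_ : IsFilledLevel G K μ), (hopping G).eigenspace (μ : ℂ)

/-- The state in which the levels `θ_0, …, θ_K` are filled: one particle is created in each
member of an orthonormal basis of the space of filled modes. (Another orthonormal basis changes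
the state by a phase only.) -/
def filledState (G : SimpleGraph V) [DecidableRel G.Adj] (K : ℕ) (S : Finset V) : Fock V :=
  (List.ofFn fun i => modeCreation S
    ((stdOrthonormalBasis ℂ (filledModes G K) i : filledModes G K) :
      EuclideanSpace ℂ V)).prod vacuum

/-- The reduced density matrix on the Fock space of `S` of the pure state `ψ`: the partial trace of
`|ψ⟩⟨ψ|` over the occupations `u` of the complement of `S`. -/
def reducedDensity (S : Finset V) (ψ : Fock V) : Matrix (Finset S) (Finset S) ℂ :=
  Matrix.of fun s t => ∑ u ∈ Sᶜ.powerset,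
    ψ (s.map (Function.Embedding.subtype _) ∪ u) *
      star (ψ (t.map (Function.Embedding.subtype _) ∪ u))

/-- The von Neumann entropy `-tr (ρ log ρ)` of a density matrix, with `0 log 0 = 0`; the matrix
logarithm is taken in the functional calculus of Hermitian matrices. -/
def vonNeumannEntropy {ι : Type*} [Fintype ι] [DecidableEq ι] (ρ : Matrix ι ι ℂ) : ℝ :=
  (-(ρ * cfc Real.log ρ).trace).re

open Classical in
/-- The subsystem of all the vertices at distance at most `l` from `x`. -/
def distBall (G : SimpleGraph V) (x : V) (l : ℕ) : Finset V :=
  Finset.univ.filter fun y => G.edist x y ≤ l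

/-- `S_{K,l}`: the entropy of entanglement of the ball of radius `l` around `x` with the rest of
the graph, when the levels `θ_0, …, θ_K` are filled. -/
def entanglementEntropy (G : SimpleGraph V) [DecidableRel G.Adj] (x : V) (K l : ℕ) : ℝ :=
  vonNeumannEntropy (reducedDensity (distBall G x l) (filledState G K (distBall G x l)))

end FreeFermion

/-! ### Hadamard graphs -/

/-- The vertices of a Hadamard graph of order `n`: `Sum.inl (i, ε)` is `r_i^ε` (row `i`) and
`Sum.inr (j, δ)` is `c_j^δ` (column `j`), where `ε` and `δ` are signs. -/
abbrev HadamardVertex (n : ℕ) : Type := (Fin n × ℤˣ) ⊕ (Fin n × ℤˣ)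

/-- Adjacency in the Hadamard graph of `H`: `r_i^ε` and `c_j^δ` are joined exactly when
`H i j = ε δ`. -/
def hadamardAdj {n : ℕ} (H : Matrix (Fin n) (Fin n) ℤ) : HadamardVertex n → HadamardVertex n → Prop
  | Sum.inl (i, ε), Sum.inr (j, δ) => H i j = ((ε * δ : ℤˣ) : ℤ)
  | Sum.inr (j, δ), Sum.inl (i, ε) => H i j = ((ε * δ : ℤˣ) : ℤ)
  | Sum.inl _, Sum.inl _ => False
  | Sum.inr _, Sum.inr _ => False

/-- The Hadamard graph of the matrix `H`. -/
def hadamardGraph {n : ℕ} (H : Matrix (Fin n) (Fin n) ℤ) : SimpleGraph (HadamardVertex n) where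
  Adj := hadamardAdj H
  symm := ⟨by
    rintro (⟨i, ε⟩ | ⟨i, ε⟩) (⟨j, δ⟩ | ⟨j, δ⟩) h <;> exact h⟩
  loopless := ⟨by
    rintro (⟨i, ε⟩ | ⟨i, ε⟩) h <;> exact h⟩

instance {n : ℕ} (H : Matrix (Fin n) (Fin n) ℤ) : DecidableRel (hadamardGraph H).Adj :=
  Classical.decRel _

/-- `S_{K,l}` for the Hadamard graph of `H` and the reference vertex `x`. -/
def hadamardEntropy {n : ℕ} (H : Matrix (Fin n) (Fin n) ℤ) (x : HadamardVertex n) (K l : ℕ) : ℝ :=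
  FreeFermion.entanglementEntropy (hadamardGraph H) x K l

end

set_option linter.unusedSectionVars false

noncomputable section

namespace FreeFermion

variable {V : Type*} [Fintype V] [DecidableEq V]

/-! ### Canonical anticommutation relations -/

/-! The entropy of a Slater state is a one-particle quantity. In the space `W` of filled modes,
choose an orthonormal basis whose restrictions to subsystem 1 stay orthogonal, by diagonalizing the
compression to `W` of the restriction map. Each basis mode splits into a part inside of squared norm
`x i` and a part outside of squared norm `1 - x i`. Expanding the product of creation operators
gives a sum, over the choices of which modes sit inside, of tensor products of mutually orthogonal
vectors. The nonzero spectrum of the reduced density matrix therefore consists of products of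
factors `x i` or `1 - x i`, and the entropy is the sum of the binary entropies `h (x i)`
(`vonNeumannEntropy_slater_add`). The nonzero `x i` are the nonzero eigenvalues of the projection
`P` onto `W`, cut down to the sites of the subsystem. Since `h x = h (1 - x)`, the complementary
sites serve equally well (`vonNeumannEntropy_eq_sum_binEntropy`).

For a Hadamard graph, the adjacency matrix is a constant part on each pair of blocks plus `oddAdj
H`, which lives on the functions odd under the antipodal map and squares to `n` times the projection
`odd n` onto them. This makes every spectral projection explicit.

The complement of a ball of radius 3 is one vertex, so the entropy is `h` of a diagonal entry of
`P`: up to `x ↦ 1 - x`, this entry is `1/4 + 1/(4n)` or `1/(4n)`. The complement of a ball of radius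
2 is a ball of radius 1 around the antipode, so the remaining cases all concern a star with `n + 1`
vertices. The star contains no antipodal pair, hence `P` restricted to it is `1/4` or `3/4` times
the identity plus a matrix of rank at most 3 (`abs_hadamardEntropy_sub_le`). All but three
eigenvalues are then known, the entropy is `(n + 1) h(1/4) + O(1)`, and `h(1/4) = 2 ln 2 - (3/4) ln
3`. -/

theorem SiteLT.irrefl (S : Finset V) (y : V) : ¬ SiteLT S y y := by
  simp [SiteLT]

theorem SiteLT.iff_not (S : Finset V) {y z : V} (h : y ≠ z) : SiteLT S y z ↔ ¬ SiteLT S z y := by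
  have h' : Fintype.equivFin V y ≠ Fintype.equivFin V z := fun e =>
    h ((Fintype.equivFin V).injective e)
  unfold SiteLT
  rcases lt_or_gt_of_ne h' with h1 | h1
  · have := not_lt.2 h1.le
    tauto
  · have := not_lt.2 h1.le
    tauto

open Classical in
/-- The sign picked up by a particle at `y` when it moves past a particle at `z`. -/
def exchangeSign (S : Finset V) (z y : V) : ℂ := if SiteLT S z y then -1 else 1

theorem exchangeSign_self (S : Finset V) (y : V) : exchangeSign S y y = 1 := by
  simp [exchangeSign, SiteLT.irrefl]

/-- Exactly one of two distinct sites precedes the other; this is the source of every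
anticommutation sign. -/
theorem exchangeSign_swap (S : Finset V) {y z : V} (h : y ≠ z) :
    exchangeSign S y z = -exchangeSign S z y := by
  unfold exchangeSign
  have := SiteLT.iff_not S h
  by_cases h1 : SiteLT S y z <;> by_cases h2 : SiteLT S z y <;> simp_all

theorem exchangeSign_mul_self (S : Finset V) (y z : V) :
    exchangeSign S y z * exchangeSign S y z = 1 := by
  unfold exchangeSign; split_ifs <;> simp

/-- The sign picked up by a particle at `y` when it moves past the particles of `s`. -/
def stringSign (S : Finset V) (y : V) (s : Finset V) : ℂ := ∏ z ∈ s, exchangeSign S z y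

theorem stringSign_mul_self (S : Finset V) (y : V) (s : Finset V) :
    stringSign S y s * stringSign S y s = 1 := by
  simp [stringSign, ← Finset.prod_mul_distrib, exchangeSign_mul_self]

theorem star_stringSign (S : Finset V) (y : V) (s : Finset V) :
    star (stringSign S y s) = stringSign S y s := by
  simp only [stringSign, star_prod]
  refine Finset.prod_congr rfl fun z _ => ?_
  unfold exchangeSign; split_ifs <;> simp

theorem stringSign_erase (S : Finset V) (y : V) {z : V} {s : Finset V} (h : z ∈ s) :
    stringSign S y (s.erase z) = exchangeSign S z y * stringSign S y s := by
  rw [stringSign, stringSign, ← Finset.mul_prod_erase s _ h, ← mul_assoc, exchangeSign_mul_self,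
    one_mul]

theorem stringSign_insert (S : Finset V) (y : V) {z : V} {s : Finset V} (h : z ∉ s) :
    stringSign S y (insert z s) = exchangeSign S z y * stringSign S y s := by
  rw [stringSign, stringSign, Finset.prod_insert h]

theorem siteCreation_apply (S : Finset V) (y : V) (ψ : Fock V) (s : Finset V) :
    siteCreation S y ψ s = if y ∈ s then stringSign S y s * ψ (s.erase y) else 0 := by
  classical
  have : stringSign S y s = (-1) ^ (s.filter fun z => SiteLT S z y).card := by
    unfold stringSign exchangeSign
    rw [Finset.prod_ite, Finset.prod_const, Finset.prod_const_one, mul_one]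
  rw [this]
  simp only [siteCreation, LinearMap.coe_mk, AddHom.coe_mk]

/-- The annihilation operator of the site `y`, the adjoint of `siteCreation S y`. -/
def siteAnnihilation (S : Finset V) (y : V) : Module.End ℂ (Fock V) where
  toFun ψ s := if y ∈ s then 0 else stringSign S y s * ψ (insert y s)
  map_add' ψ φ := by
    funext s
    by_cases h : y ∈ s <;> simp [h, mul_add]
  map_smul' a ψ := by
    funext s
    by_cases h : y ∈ s <;> simp [h, mul_left_comm]

theorem siteAnnihilation_apply (S : Finset V) (y : V) (ψ : Fock V) (s : Finset V) :
    siteAnnihilation S y ψ s = if y ∈ s then 0 else stringSign S y s * ψ (insert y s) := rfl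

theorem siteCreation_anticomm (S : Finset V) (y z : V) :
    siteCreation S y * siteCreation S z = -(siteCreation S z * siteCreation S y) := by
  refine LinearMap.ext fun ψ => funext fun s => ?_
  simp only [Module.End.mul_apply, LinearMap.neg_apply, Pi.neg_apply, siteCreation_apply,
    Finset.mem_erase]
  by_cases hyz : y = z
  · simp [hyz]
  by_cases hy : y ∈ s <;> by_cases hz : z ∈ s <;> simp [hy, hz, hyz, Ne.symm hyz]
  rw [stringSign_erase _ _ hy, stringSign_erase _ _ hz, Finset.erase_right_comm,
    exchangeSign_swap S hyz]
  ring

theorem siteAnnihilation_mul_siteCreation (S : Finset V) (y z : V) :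
    siteAnnihilation S y * siteCreation S z =
      (if y = z then 1 else 0) - siteCreation S z * siteAnnihilation S y := by
  refine LinearMap.ext fun ψ => funext fun s => ?_
  simp only [Module.End.mul_apply, LinearMap.sub_apply, Pi.sub_apply, siteCreation_apply,
    siteAnnihilation_apply, Finset.mem_erase, Finset.mem_insert]
  by_cases hyz : y = z
  · subst hyz
    by_cases hy : y ∈ s
    · simp [hy, stringSign_erase, exchangeSign_self, ← mul_assoc, stringSign_mul_self]
    · simp [hy, stringSign_insert, exchangeSign_self, ← mul_assoc, stringSign_mul_self]
  · by_cases hy : y ∈ s <;> by_cases hz : z ∈ s <;> simp [hy, hz, hyz, Ne.symm hyz]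
    rw [stringSign_erase _ _ hz, stringSign_insert _ _ hy, exchangeSign_swap S hyz,
      Finset.erase_insert_of_ne hyz]
    ring

/-- Removing and inserting `y` are inverse bijections between the configurations with and without
`y`, and the string sign is the same on both sides. -/
theorem star_siteCreation_dotProduct (S : Finset V) (y : V) (ψ φ : Fock V) :
    star (siteCreation S y ψ) ⬝ᵥ φ = star ψ ⬝ᵥ siteAnnihilation S y φ := by
  simp only [dotProduct, Pi.star_apply, siteCreation_apply, siteAnnihilation_apply]
  have h1 : ∀ s : Finset V, star (if y ∈ s then stringSign S y s * ψ (s.erase y) else 0) * φ s =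
      if y ∈ s then stringSign S y s * star (ψ (s.erase y)) * φ s else 0 := by
    intro s; split_ifs
    · rw [star_mul', star_stringSign]
    · simp
  have h2 : ∀ s : Finset V, star (ψ s) * (if y ∈ s then 0 else stringSign S y s * φ (insert y s)) =
      if y ∉ s then stringSign S y s * star (ψ s) * φ (insert y s) else 0 := by
    intro s; split_ifs <;> ring
  simp only [h1, h2]
  rw [← Finset.sum_filter, ← Finset.sum_filter]
  refine Finset.sum_nbij' (fun s => s.erase y) (fun s => insert y s) ?_ ?_ ?_ ?_ ?_
  · simp
  · simp
  · intro s hs; exact Finset.insert_erase (by simpa using hs)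
  · intro s hs; exact Finset.erase_insert (by simpa using hs)
  · intro s hs
    have hs : y ∈ s := by simpa using hs
    simp only [Finset.insert_erase hs, stringSign_erase _ _ hs, exchangeSign_self, one_mul]

/-- The annihilation operator of the one-particle state `w`. -/
def modeAnnihilation (S : Finset V) (w : EuclideanSpace ℂ V) : Module.End ℂ (Fock V) :=
  ∑ y, star (w y) • siteAnnihilation S y

/-- Pauli principle: exchanging the two summation indices shows that the square equals its own
negative. This lets creation operators factor through the exterior algebra. -/
theorem modeCreation_mul_self (S : Finset V) (w : EuclideanSpace ℂ V) :
    modeCreation S w * modeCreation S w = 0 := by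
  have h : modeCreation S w * modeCreation S w = -(modeCreation S w * modeCreation S w) := by
    unfold modeCreation
    simp only [Finset.sum_mul_sum, smul_mul_smul_comm]
    conv_lhs => rw [Finset.sum_comm]
    rw [← Finset.sum_neg_distrib]
    refine Finset.sum_congr rfl fun y _ => ?_
    rw [← Finset.sum_neg_distrib]
    refine Finset.sum_congr rfl fun z _ => ?_
    rw [siteCreation_anticomm, smul_neg, mul_comm (w z)]
  have h2 : (2 : ℂ) • (modeCreation S w * modeCreation S w) = 0 := by
    rw [two_smul]
    nth_rewrite 1 [h]
    exact neg_add_cancel _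
  exact (smul_eq_zero.1 h2).resolve_left two_ne_zero

theorem modeAnnihilation_mul_modeCreation (S : Finset V) (v w : EuclideanSpace ℂ V) :
    modeAnnihilation S v * modeCreation S w =
      inner ℂ v w • 1 - modeCreation S w * modeAnnihilation S v := by
  have hi : inner ℂ v w = ∑ y, star (v y) * w y := by
    simp [PiLp.inner_apply, mul_comm]
  unfold modeCreation modeAnnihilation
  simp only [Finset.sum_mul_sum, smul_mul_smul_comm]
  conv_rhs => rw [Finset.sum_comm]
  simp only [siteAnnihilation_mul_siteCreation, smul_sub, Finset.sum_sub_distrib]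
  congr 1
  · rw [hi, Finset.sum_smul]
    simp
  · simp only [mul_comm]

theorem star_modeCreation_dotProduct (S : Finset V) (w : EuclideanSpace ℂ V) (ψ φ : Fock V) :
    star (modeCreation S w ψ) ⬝ᵥ φ = star ψ ⬝ᵥ modeAnnihilation S w φ := by
  simp only [modeCreation, modeAnnihilation, LinearMap.sum_apply, LinearMap.smul_apply, star_sum,
    star_smul, sum_dotProduct, dotProduct_sum, smul_dotProduct, dotProduct_smul,
    star_siteCreation_dotProduct]

theorem modeAnnihilation_vacuum (S : Finset V) (w : EuclideanSpace ℂ V) :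
    modeAnnihilation S w vacuum = 0 := by
  simp only [modeAnnihilation, LinearMap.sum_apply, LinearMap.smul_apply]
  refine Finset.sum_eq_zero fun y _ => ?_
  convert smul_zero _
  funext s
  rw [siteAnnihilation_apply]
  split_ifs
  · rfl
  · simp [vacuum, Finset.insert_ne_empty]

/-- Fermion parity, `(-1) ^ (number of particles)`. -/
def parity : Module.End ℂ (Fock V) where
  toFun ψ s := (-1) ^ s.card * ψ s
  map_add' ψ φ := by funext s; simp [mul_add]
  map_smul' a ψ := by funext s; simp [mul_left_comm]

theorem parity_apply (ψ : Fock V) (s : Finset V) : parity ψ s = (-1) ^ s.card * ψ s := rfl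

theorem star_parity_dotProduct_parity (ψ φ : Fock V) :
    star (parity ψ) ⬝ᵥ parity φ = star ψ ⬝ᵥ φ := by
  simp only [dotProduct, Pi.star_apply, parity_apply, star_mul', star_pow, star_neg, star_one]
  refine Finset.sum_congr rfl fun s _ => ?_
  rw [mul_mul_mul_comm, ← mul_pow]
  simp

theorem modeAnnihilation_parity (S : Finset V) (w : EuclideanSpace ℂ V) (ψ : Fock V) :
    modeAnnihilation S w (parity ψ) = -parity (modeAnnihilation S w ψ) := by
  simp only [modeAnnihilation, LinearMap.sum_apply, LinearMap.smul_apply, map_sum, map_smul,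
    ← Finset.sum_neg_distrib, ← smul_neg]
  refine Finset.sum_congr rfl fun y _ => ?_
  congr 1
  funext s
  simp only [siteAnnihilation_apply, parity_apply, Pi.neg_apply]
  split_ifs with h
  · simp
  · rw [Finset.card_insert_of_notMem h, pow_succ]; ring

end FreeFermion

/-! ### Spectral sums of Hermitian matrices -/

namespace Matrix

variable {m k : Type*} [Fintype m] [DecidableEq m] [Fintype k] [DecidableEq k]

/-- The nonzero spectrum of `A * B` is that of `B * A`. -/
theorem IsHermitian.sum_eigenvalues_of_eq_mul {C : Matrix m m ℂ} (hC : C.IsHermitian)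
    (A : Matrix m k ℂ) (B : Matrix k m ℂ) (hAB : C = A * B) (d : k → ℝ)
    (hBA : B * A = diagonal fun i => (d i : ℂ)) (f : ℝ → ℝ) (hf : f 0 = 0) :
    ∑ i, f (hC.eigenvalues i) = ∑ i, f (d i) := by
  -- The two characteristic polynomials agree up to powers of `X`; the extra roots are zero and
  -- contribute `f 0 = 0`.
  have h := Matrix.charpoly_mul_comm' A B
  rw [← hAB, hBA, charpoly_diagonal] at h
  have h' := congrArg (fun p => ((Polynomial.roots p).map fun z => f z.re).sum) h
  have hprod : (∏ i, (Polynomial.X - Polynomial.C (d i : ℂ))) ≠ 0 :=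
    (Polynomial.monic_prod_of_monic _ _ fun i _ => Polynomial.monic_X_sub_C _).ne_zero
  have hX : ∀ j : ℕ, (Polynomial.X ^ j : Polynomial ℂ) ≠ 0 := fun j =>
    pow_ne_zero _ Polynomial.X_ne_zero
  beta_reduce at h'
  rw [Polynomial.roots_mul (mul_ne_zero (hX _) C.charpoly_monic.ne_zero),
    Polynomial.roots_mul (mul_ne_zero (hX _) hprod), hC.roots_charpoly_eq_eigenvalues,
    Polynomial.roots_prod _ _ hprod] at h'
  simpa [hf, Function.comp_def, Polynomial.roots_X_pow, Multiset.map_nsmul, Multiset.sum_nsmul]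
    using h'

end Matrix

namespace FreeFermion

theorem vonNeumannEntropy_eq_sum {ι : Type*} [Fintype ι] [DecidableEq ι] {ρ : Matrix ι ι ℂ}
    (hρ : ρ.IsHermitian) : vonNeumannEntropy ρ = ∑ i, Real.negMulLog (hρ.eigenvalues i) := by
  unfold vonNeumannEntropy
  rw [hρ.cfc_eq, Matrix.IsHermitian.cfc]
  nth_rewrite 1 [hρ.spectral_theorem]
  rw [← map_mul, Unitary.conjStarAlgAut_apply, Matrix.trace_mul_cycle, Unitary.coe_star_mul_self,
    one_mul, Matrix.diagonal_mul_diagonal, Matrix.trace_diagonal]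
  simp only [Function.comp_apply, Complex.coe_algebraMap, ← Complex.ofReal_mul, Real.negMulLog,
    ← Complex.ofReal_sum, Complex.neg_re, Complex.ofReal_re]
  rw [← Finset.sum_neg_distrib]
  simp

/-- The entropy of a state whose eigenvalues are products of `x i true` or `x i false`, where
`x i true + x i false = 1`. -/
theorem sum_negMulLog_prod {n : ℕ} (x : Fin n → ℝ) :
    ∑ T : Fin n → Bool, Real.negMulLog (∏ i, if T i then x i else 1 - x i) =
      ∑ i, Real.binEntropy (x i) := by
  have hone : ∀ {n : ℕ} (x : Fin n → ℝ), ∑ T : Fin n → Bool,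
      (∏ i, if T i then x i else 1 - x i) = 1 := by
    intro n x
    have := Fintype.prod_sum (fun (i : Fin n) (b : Bool) => if b then x i else 1 - x i)
    rw [← this]
    simp
  induction n with
  | zero => simp
  | succ n ih =>
    -- Split off the first factor: `negMulLog (x * y)` is `y * negMulLog x + x * negMulLog y`, and
    -- the weights of either factor sum to one.
    rw [← (Fin.consEquiv fun _ => Bool).sum_comp, Fintype.sum_prod_type, Fin.sum_univ_succ,
      ← ih fun i => x i.succ]
    simp only [Fin.consEquiv_apply, Fin.prod_univ_succ, Fin.cons_zero, Fin.cons_succ,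
      Fintype.sum_bool, if_true, Real.negMulLog_mul, Finset.sum_add_distrib]
    simp only [← Finset.mul_sum, ← Finset.sum_mul, hone,
      Real.binEntropy_eq_negMulLog_add_negMulLog_one_sub]
    simp
    ring

/-! ### Slater states -/

variable {V : Type*} [Fintype V] [DecidableEq V]

/-- The state with one particle in each of the modes `v 0, …, v (n - 1)`. -/
def slater (S : Finset V) {n : ℕ} (v : Fin n → EuclideanSpace ℂ V) : Fock V :=
  (List.ofFn fun i => modeCreation S (v i)).prod vacuum

/-- Creation of a particle, as a linear map of its one-particle state. -/
def modeCreationLinear (S : Finset V) : EuclideanSpace ℂ V →ₗ[ℂ] Module.End ℂ (Fock V) where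
  toFun := modeCreation S
  map_add' v w := by simp [modeCreation, add_smul, Finset.sum_add_distrib]
  map_smul' a w := by simp [modeCreation, Finset.smul_sum, smul_smul]

theorem modeCreation_add (S : Finset V) (v w : EuclideanSpace ℂ V) :
    modeCreation S (v + w) = modeCreation S v + modeCreation S w :=
  (modeCreationLinear S).map_add v w

/-- Slater states depend on their modes in an alternating way. -/
def slaterAlternating (S : Finset V) (n : ℕ) (s : Finset V) :
    EuclideanSpace ℂ V [⋀^Fin n]→ₗ[ℂ] ℂ :=
  ((LinearMap.proj s ∘ₗ LinearMap.applyₗ (vacuum : Fock V)) ∘ₗ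
    (ExteriorAlgebra.lift ℂ ⟨modeCreationLinear S, modeCreation_mul_self S⟩).toLinearMap
    ).compAlternatingMap (ExteriorAlgebra.ιMulti ℂ n)

theorem slaterAlternating_apply (S : Finset V) (n : ℕ) (s : Finset V)
    (v : Fin n → EuclideanSpace ℂ V) : slaterAlternating S n s v = slater S v s := by
  simp only [slaterAlternating, LinearMap.compAlternatingMap_apply, LinearMap.comp_apply,
    ExteriorAlgebra.ιMulti_apply, AlgHom.toLinearMap_apply, map_list_prod, List.map_ofFn,
    Function.comp_def, LinearMap.applyₗ_apply_apply,
    LinearMap.proj_apply]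
  have h : ∀ w, ExteriorAlgebra.lift ℂ ⟨modeCreationLinear S, modeCreation_mul_self S⟩
      (ExteriorAlgebra.ι ℂ w) = modeCreation S w :=
    ExteriorAlgebra.lift_ι_apply ℂ (modeCreationLinear S) (modeCreation_mul_self S)
  simp only [h]
  rfl

/-- On the `n`-dimensional space `W`, every alternating `n`-form is a multiple of the determinant,
and the determinant between two orthonormal bases has modulus one. It frees the choice of basis in
`filledState`. -/
theorem exists_slater_eq_smul (S : Finset V) {n : ℕ} {W : Submodule ℂ (EuclideanSpace ℂ V)}
    (b b' : OrthonormalBasis (Fin n) ℂ W) :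
    ∃ c : ℂ, ‖c‖ = 1 ∧ slater S (fun i => (b' i : EuclideanSpace ℂ V)) =
      c • slater S (fun i => (b i : EuclideanSpace ℂ V)) := by
  refine ⟨b.toBasis.det b', b.det_to_matrix_orthonormalBasis b', funext fun s => ?_⟩
  have h := congrArg (fun g => g b') (((slaterAlternating S n s).compLinearMap
    W.subtype).eq_smul_basis_det b.toBasis)
  simp only [AlternatingMap.compLinearMap_apply, AlternatingMap.smul_apply,
    OrthonormalBasis.coe_toBasis, slaterAlternating_apply, smul_eq_mul,
    Submodule.subtype_apply] at h
  rw [Pi.smul_apply, smul_eq_mul, mul_comm, ← h]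

theorem reducedDensity_smul (S : Finset V) (ψ : Fock V) {c : ℂ} (hc : ‖c‖ = 1) :
    reducedDensity S (c • ψ) = reducedDensity S ψ := by
  have h : c * star c = 1 := by
    rw [Complex.star_def, Complex.mul_conj, Complex.normSq_eq_norm_sq, hc]; simp
  ext s t
  simp only [reducedDensity, Matrix.of_apply, Pi.smul_apply, smul_eq_mul, star_mul']
  refine Finset.sum_congr rfl fun u _ => ?_
  rw [mul_mul_mul_comm, h, one_mul]

/-! ### Factorization with respect to a bipartition of the sites -/

/-- The product of a state of the sites of `S` and a state of the other sites. -/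
def tensor (S : Finset V) (φ χ : Fock V) : Fock V := fun s => φ (s ∩ S) * χ (s \ S)

theorem tensor_vacuum (S : Finset V) : tensor S vacuum vacuum = (vacuum : Fock V) := by
  funext s
  unfold tensor vacuum
  by_cases hs : s = ∅
  · simp [hs]
  · rw [Pi.single_eq_of_ne hs]
    by_cases h : s ∩ S = ∅
    · rw [Pi.single_eq_of_ne (i := ∅) (i' := s \ S), mul_zero]
      intro h'
      apply hs
      rw [← Finset.sdiff_union_inter s S, h, h', Finset.union_empty]
    · rw [Pi.single_eq_of_ne h, zero_mul]

theorem exchangeSign_of_mem {S : Finset V} {y z : V} (hy : y ∈ S) (hz : z ∉ S) :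
    exchangeSign S z y = 1 := by
  simp [exchangeSign, SiteLT, hy, hz]

theorem exchangeSign_of_notMem {S : Finset V} {y z : V} (hy : y ∉ S) (hz : z ∈ S) :
    exchangeSign S z y = -1 := by
  simp [exchangeSign, SiteLT, hy, hz]

theorem stringSign_eq_mul (S : Finset V) (y : V) (s : Finset V) :
    stringSign S y s = stringSign S y (s ∩ S) * stringSign S y (s \ S) := by
  unfold stringSign
  rw [Finset.prod_inter_mul_prod_sdiff]

/-- The sites of `S` come first in the ordering, so particles outside `S` contribute no sign. -/
theorem siteCreation_tensor_of_mem {S : Finset V} {y : V} (hy : y ∈ S) (φ χ : Fock V) :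
    siteCreation S y (tensor S φ χ) = tensor S (siteCreation S y φ) χ := by
  funext s
  have h2 : stringSign S y (s \ S) = 1 := Finset.prod_eq_one fun z hz =>
    exchangeSign_of_mem hy (Finset.mem_sdiff.1 hz).2
  have e1 : s.erase y ∩ S = (s ∩ S).erase y := by ext; simp
  have e2 : s.erase y \ S = s \ S := by ext; simp; grind
  simp only [tensor, siteCreation_apply, Finset.mem_inter, hy, and_true, e1, e2]
  rw [stringSign_eq_mul, h2]
  split_ifs <;> ring

/-- A site outside `S` comes after all of `S`, so the new particle passes every particle in `S`;
this sign is the parity of the inner factor. -/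
theorem siteCreation_tensor_of_notMem {S : Finset V} {y : V} (hy : y ∉ S) (φ χ : Fock V) :
    siteCreation S y (tensor S φ χ) = tensor S (parity φ) (siteCreation S y χ) := by
  funext s
  have h2 : stringSign S y (s ∩ S) = (-1) ^ (s ∩ S).card := by
    rw [← Finset.prod_const]
    exact Finset.prod_congr rfl fun z hz =>
      exchangeSign_of_notMem hy (Finset.mem_inter.1 hz).2
  have e1 : s.erase y ∩ S = s ∩ S := by ext; simp; grind
  have e2 : s.erase y \ S = (s \ S).erase y := by ext; simp; tauto
  simp only [tensor, siteCreation_apply, Finset.mem_sdiff, hy, not_false_iff, and_true, e1, e2,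
    parity_apply]
  rw [stringSign_eq_mul, h2]
  split_ifs <;> ring

theorem tensor_sum_left (S : Finset V) {ι : Type*} (t : Finset ι) (φ : ι → Fock V) (χ : Fock V) :
    tensor S (∑ i ∈ t, φ i) χ = ∑ i ∈ t, tensor S (φ i) χ := by
  funext s; simp [tensor, Finset.sum_mul]

theorem tensor_sum_right (S : Finset V) {ι : Type*} (t : Finset ι) (φ : Fock V) (χ : ι → Fock V) :
    tensor S φ (∑ i ∈ t, χ i) = ∑ i ∈ t, tensor S φ (χ i) := by
  funext s; simp [tensor, Finset.mul_sum]

theorem tensor_smul_left (S : Finset V) (c : ℂ) (φ χ : Fock V) :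
    tensor S (c • φ) χ = c • tensor S φ χ := by
  funext s; simp [tensor, mul_assoc]

theorem tensor_smul_right (S : Finset V) (c : ℂ) (φ χ : Fock V) :
    tensor S φ (c • χ) = c • tensor S φ χ := by
  funext s; simp [tensor, mul_left_comm]

theorem modeCreation_tensor_of_supported {S : Finset V} {a : EuclideanSpace ℂ V}
    (ha : ∀ y ∉ S, a y = 0) (φ χ : Fock V) :
    modeCreation S a (tensor S φ χ) = tensor S (modeCreation S a φ) χ := by
  simp only [modeCreation, LinearMap.sum_apply, LinearMap.smul_apply, tensor_sum_left,
    tensor_smul_left]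
  refine Finset.sum_congr rfl fun y _ => ?_
  by_cases hy : y ∈ S
  · rw [siteCreation_tensor_of_mem hy]
  · simp [ha y hy]

theorem modeCreation_tensor_of_supported_compl {S : Finset V} {b : EuclideanSpace ℂ V}
    (hb : ∀ y ∈ S, b y = 0) (φ χ : Fock V) :
    modeCreation S b (tensor S φ χ) = tensor S (parity φ) (modeCreation S b χ) := by
  simp only [modeCreation, LinearMap.sum_apply, LinearMap.smul_apply, tensor_sum_right,
    tensor_smul_right]
  refine Finset.sum_congr rfl fun y _ => ?_
  by_cases hy : y ∈ S
  · simp [hb y hy]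
  · rw [siteCreation_tensor_of_notMem hy]

/-- The factor on `S` of the term of a Slater state in which the modes in `T` sit in `S`. -/
def innerFactor (S : Finset V) {n : ℕ} (a : Fin n → EuclideanSpace ℂ V) (T : Fin n → Bool) :
    Fock V :=
  (List.ofFn fun i => if T i then modeCreation S (a i) else parity).prod vacuum

/-- The factor off `S` of the term of a Slater state in which the modes in `T` sit in `S`. -/
def outerFactor (S : Finset V) {n : ℕ} (b : Fin n → EuclideanSpace ℂ V) (T : Fin n → Bool) :
    Fock V :=
  (List.ofFn fun i => if T i then 1 else modeCreation S (b i)).prod vacuum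

theorem innerFactor_succ (S : Finset V) {n : ℕ} (a : Fin (n + 1) → EuclideanSpace ℂ V)
    (T : Fin (n + 1) → Bool) :
    innerFactor S a T = (if T 0 then modeCreation S (a 0) else parity)
      (innerFactor S (fun i => a i.succ) fun i => T i.succ) := by
  simp only [innerFactor, List.ofFn_succ, List.prod_cons]
  rfl

theorem outerFactor_succ (S : Finset V) {n : ℕ} (b : Fin (n + 1) → EuclideanSpace ℂ V)
    (T : Fin (n + 1) → Bool) :
    outerFactor S b T = (if T 0 then 1 else modeCreation S (b 0))
      (outerFactor S (fun i => b i.succ) fun i => T i.succ) := by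
  simp only [outerFactor, List.ofFn_succ, List.prod_cons]
  rfl

theorem slater_add_eq_sum_tensor (S : Finset V) {n : ℕ} (a b : Fin n → EuclideanSpace ℂ V)
    (ha : ∀ i, ∀ y ∉ S, a i y = 0) (hb : ∀ i, ∀ y ∈ S, b i y = 0) :
    slater S (fun i => a i + b i) =
      ∑ T : Fin n → Bool, tensor S (innerFactor S a T) (outerFactor S b T) := by
  induction n with
  | zero => simp [slater, innerFactor, outerFactor, tensor_vacuum]
  | succ n ih =>
    have h : slater S (fun i => a i + b i) = modeCreation S (a 0 + b 0)
        (slater S fun i : Fin n => a i.succ + b i.succ) := by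
      simp [slater, List.ofFn_succ]
    rw [h, ih _ _ (fun i => ha i.succ) (fun i => hb i.succ), modeCreation_add,
      LinearMap.add_apply, map_sum, map_sum, ← (Fin.consEquiv fun _ => Bool).sum_comp,
      Fintype.sum_prod_type, Fintype.sum_bool]
    simp [innerFactor_succ, outerFactor_succ, modeCreation_tensor_of_supported (ha 0),
      modeCreation_tensor_of_supported_compl (hb 0)]

theorem modeAnnihilation_modeCreation_of_inner_eq_zero (S : Finset V) {v w : EuclideanSpace ℂ V}
    (h : inner ℂ v w = 0) (ψ : Fock V) :
    modeAnnihilation S v (modeCreation S w ψ) = -modeCreation S w (modeAnnihilation S v ψ) := by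
  have := LinearMap.congr_fun (modeAnnihilation_mul_modeCreation S v w) ψ
  simpa [h] using this

/-- The annihilation operator moves, up to sign, past creation in orthogonal modes and past parity
until it reaches the vacuum. -/
theorem modeAnnihilation_innerFactor (S : Finset V) {n : ℕ} (v : EuclideanSpace ℂ V)
    (a : Fin n → EuclideanSpace ℂ V) (h : ∀ i, inner ℂ v (a i) = 0) (T : Fin n → Bool) :
    modeAnnihilation S v (innerFactor S a T) = 0 := by
  induction n with
  | zero => simp [innerFactor, modeAnnihilation_vacuum]
  | succ n ih =>
    have ih' := ih (fun i => a i.succ) (fun i => h i.succ) (fun i => T i.succ)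
    rw [innerFactor_succ]
    split_ifs
    · rw [modeAnnihilation_modeCreation_of_inner_eq_zero S (h 0), ih', map_zero, neg_zero]
    · rw [modeAnnihilation_parity, ih', map_zero, neg_zero]

theorem modeAnnihilation_outerFactor (S : Finset V) {n : ℕ} (v : EuclideanSpace ℂ V)
    (a : Fin n → EuclideanSpace ℂ V) (h : ∀ i, inner ℂ v (a i) = 0) (T : Fin n → Bool) :
    modeAnnihilation S v (outerFactor S a T) = 0 := by
  induction n with
  | zero => simp [outerFactor, modeAnnihilation_vacuum]
  | succ n ih =>
    have ih' := ih (fun i => a i.succ) (fun i => h i.succ) (fun i => T i.succ)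
    rw [outerFactor_succ]
    split_ifs
    · simpa using ih'
    · rw [modeAnnihilation_modeCreation_of_inner_eq_zero S (h 0), ih', map_zero, neg_zero]

theorem star_modeCreation_dotProduct_modeCreation (S : Finset V) (w : EuclideanSpace ℂ V)
    (ψ φ : Fock V) (h : modeAnnihilation S w φ = 0) :
    star (modeCreation S w ψ) ⬝ᵥ modeCreation S w φ = inner ℂ w w * (star ψ ⬝ᵥ φ) := by
  have := LinearMap.congr_fun (modeAnnihilation_mul_modeCreation S w w) φ
  rw [Module.End.mul_apply] at this
  rw [star_modeCreation_dotProduct, this]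
  simp [h]

theorem vacuum_dotProduct_vacuum : star (vacuum : Fock V) ⬝ᵥ vacuum = 1 := by
  simp [vacuum]

/-- Peel off the first mode. If only one side contains it, its adjoint annihilates the other side;
if both do, it contributes its squared norm; if neither does, parity is an isometry. -/
theorem star_innerFactor_dotProduct (S : Finset V) {n : ℕ} (a : Fin n → EuclideanSpace ℂ V)
    (h : ∀ i j, i ≠ j → inner ℂ (a i) (a j) = 0) (T T' : Fin n → Bool) :
    star (innerFactor S a T) ⬝ᵥ innerFactor S a T' =
      if T = T' then ∏ i, (if T i then inner ℂ (a i) (a i) else 1) else 0 := by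
  induction n with
  | zero => simp [innerFactor, vacuum_dotProduct_vacuum, Subsingleton.elim T T']
  | succ n ih =>
    have ih' := ih (fun i => a i.succ)
      (fun i j hij => h _ _ ((Fin.succ_injective n).ne hij)) (fun i => T i.succ) (fun i => T' i.succ)
    have h0 : ∀ T : Fin n → Bool, modeAnnihilation S (a 0)
        (innerFactor S (fun i => a i.succ) T) = 0 :=
      modeAnnihilation_innerFactor S _ _ fun i => h _ _ (Fin.succ_ne_zero i).symm
    have hT : T = T' ↔ T 0 = T' 0 ∧ (fun i : Fin n => T i.succ) = fun i => T' i.succ := by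
      simp [funext_iff, Fin.forall_fin_succ]
    have hstar : ∀ ψ φ : Fock V, star (modeCreation S (a 0) ψ) ⬝ᵥ φ = 0 →
        star φ ⬝ᵥ modeCreation S (a 0) ψ = 0 := fun ψ φ h => by
      rw [Matrix.star_dotProduct, h, star_zero]
    rw [innerFactor_succ, innerFactor_succ, Fin.prod_univ_succ]
    simp only [hT]
    cases hT0 : T 0 <;> cases hT0' : T' 0 <;> simp [-inner_self_eq_norm_sq_to_K]
    · rw [star_parity_dotProduct_parity, ih']
    · apply hstar
      rw [star_modeCreation_dotProduct, modeAnnihilation_parity, h0]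
      simp
    · rw [star_modeCreation_dotProduct, modeAnnihilation_parity, h0]
      simp
    · rw [star_modeCreation_dotProduct_modeCreation _ _ _ _ (h0 _), ih']
      split_ifs <;> simp

theorem star_outerFactor_dotProduct (S : Finset V) {n : ℕ} (a : Fin n → EuclideanSpace ℂ V)
    (h : ∀ i j, i ≠ j → inner ℂ (a i) (a j) = 0) (T T' : Fin n → Bool) :
    star (outerFactor S a T) ⬝ᵥ outerFactor S a T' =
      if T = T' then ∏ i, (if T i then 1 else inner ℂ (a i) (a i)) else 0 := by
  induction n with
  | zero => simp [outerFactor, vacuum_dotProduct_vacuum, Subsingleton.elim T T']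
  | succ n ih =>
    have ih' := ih (fun i => a i.succ)
      (fun i j hij => h _ _ ((Fin.succ_injective n).ne hij)) (fun i => T i.succ) (fun i => T' i.succ)
    have h0 : ∀ T : Fin n → Bool, modeAnnihilation S (a 0)
        (outerFactor S (fun i => a i.succ) T) = 0 :=
      modeAnnihilation_outerFactor S _ _ fun i => h _ _ (Fin.succ_ne_zero i).symm
    have hT : T = T' ↔ T 0 = T' 0 ∧ (fun i : Fin n => T i.succ) = fun i => T' i.succ := by
      simp [funext_iff, Fin.forall_fin_succ]
    have hstar : ∀ ψ φ : Fock V, star (modeCreation S (a 0) ψ) ⬝ᵥ φ = 0 →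
        star φ ⬝ᵥ modeCreation S (a 0) ψ = 0 := fun ψ φ h => by
      rw [Matrix.star_dotProduct, h, star_zero]
    rw [outerFactor_succ, outerFactor_succ, Fin.prod_univ_succ]
    simp only [hT]
    cases hT0 : T 0 <;> cases hT0' : T' 0 <;> simp [-inner_self_eq_norm_sq_to_K]
    · rw [star_modeCreation_dotProduct_modeCreation _ _ _ _ (h0 _), ih']
      split_ifs <;> simp
    · rw [star_modeCreation_dotProduct, h0]
      simp
    · apply hstar
      rw [star_modeCreation_dotProduct, h0]
      simp
    · rw [ih']

theorem modeCreation_apply (S : Finset V) (w : EuclideanSpace ℂ V) (ψ : Fock V) (s : Finset V) :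
    modeCreation S w ψ s = ∑ y, w y * siteCreation S y ψ s := by
  simp [modeCreation]

theorem innerFactor_eq_zero {S : Finset V} {n : ℕ} {a : Fin n → EuclideanSpace ℂ V}
    (ha : ∀ i, ∀ y ∉ S, a i y = 0) (T : Fin n → Bool) {s : Finset V} (hs : ¬ s ⊆ S) :
    innerFactor S a T s = 0 := by
  induction n generalizing s with
  | zero =>
    have : s ≠ ∅ := by rintro rfl; simp at hs
    simp [innerFactor, vacuum, this]
  | succ n ih =>
    rw [innerFactor_succ]
    split_ifs
    · rw [modeCreation_apply]
      refine Finset.sum_eq_zero fun y _ => ?_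
      by_cases hy : y ∈ S
      · rw [siteCreation_apply, ih fun i => ha i.succ]
        · simp
        · contrapose! hs
          intro z hz
          by_cases hzy : z = y
          · exact hzy ▸ hy
          · exact hs (Finset.mem_erase.2 ⟨hzy, hz⟩)
      · rw [ha 0 y hy, zero_mul]
    · rw [parity_apply, ih (fun i => ha i.succ) _ hs, mul_zero]

theorem outerFactor_eq_zero {S : Finset V} {n : ℕ} {b : Fin n → EuclideanSpace ℂ V}
    (hb : ∀ i, ∀ y ∈ S, b i y = 0) (T : Fin n → Bool) {s : Finset V} (hs : ¬ s ⊆ Sᶜ) :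
    outerFactor S b T s = 0 := by
  induction n generalizing s with
  | zero =>
    have : s ≠ ∅ := by rintro rfl; simp at hs
    simp [outerFactor, vacuum, this]
  | succ n ih =>
    rw [outerFactor_succ]
    split_ifs
    · exact ih (fun i => hb i.succ) _ hs
    · rw [modeCreation_apply]
      refine Finset.sum_eq_zero fun y _ => ?_
      by_cases hy : y ∈ S
      · rw [hb 0 y hy, zero_mul]
      · rw [siteCreation_apply, ih fun i => hb i.succ]
        · simp
        · contrapose! hs
          intro z hz
          by_cases hzy : z = y
          · simpa [hzy] using hy
          · exact hs (Finset.mem_erase.2 ⟨hzy, hz⟩)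

/-! ### Entropy of a Slater state -/

theorem reducedDensity_isHermitian (S : Finset V) (ψ : Fock V) :
    (reducedDensity S ψ).IsHermitian := by
  ext s t
  simp only [reducedDensity, Matrix.conjTranspose_apply, Matrix.of_apply, star_sum, star_mul',
    star_star]
  exact Finset.sum_congr rfl fun u _ => mul_comm _ _

theorem sum_map_subtype (S : Finset V) (f : Finset V → ℂ) (hf : ∀ s, ¬ s ⊆ S → f s = 0) :
    ∑ s : Finset S, f (s.map (Function.Embedding.subtype _)) = ∑ s, f s := by
  rw [← Finset.sum_subset (Finset.subset_univ S.powerset)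
    fun s _ hs => hf s fun h => hs (Finset.mem_powerset.2 h)]
  refine Finset.sum_nbij' (fun s => s.map (Function.Embedding.subtype _))
    (fun s => s.subtype (· ∈ S)) ?_ ?_ ?_ ?_ ?_
  · intro s _
    simp only [Finset.mem_powerset]
    intro y hy
    obtain ⟨z, _, rfl⟩ := Finset.mem_map.1 hy
    exact z.2
  · simp
  · intro s _
    ext y
    simp
  · intro s hs
    have hs := Finset.mem_powerset.1 hs
    rw [Finset.subtype_map]
    exact Finset.filter_true_of_mem fun y hy => hs hy
  · simp

/-- If the orthogonal modes `a i + b i` split into orthogonal parts on and off `S`, then the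
spectrum of the reduced density matrix consists of products of the weights of these parts. -/
theorem vonNeumannEntropy_slater_add (S : Finset V) {n : ℕ} (a b : Fin n → EuclideanSpace ℂ V)
    (ha : ∀ i, ∀ y ∉ S, a i y = 0) (hb : ∀ i, ∀ y ∈ S, b i y = 0) (x : Fin n → ℝ)
    (haa : ∀ i j, inner ℂ (a i) (a j) = if i = j then (x i : ℂ) else 0)
    (hbb : ∀ i j, inner ℂ (b i) (b j) = if i = j then (1 - x i : ℂ) else 0) :
    vonNeumannEntropy (reducedDensity S (slater S fun i => a i + b i)) =
      ∑ i, Real.binEntropy (x i) := by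
  set p : (Fin n → Bool) → ℝ := fun T => ∏ i, if T i then x i else 1
  set q : (Fin n → Bool) → ℝ := fun T => ∏ i, if T i then 1 else 1 - x i
  have hp : ∀ T T', star (innerFactor S a T) ⬝ᵥ innerFactor S a T' =
      if T = T' then (p T : ℂ) else 0 := fun T T' => by
    rw [star_innerFactor_dotProduct S a fun i j hij => by rw [haa, if_neg hij]]
    simp only [haa, if_true, p, Complex.ofReal_prod, apply_ite Complex.ofReal, Complex.ofReal_one]
  have hq : ∀ T T', star (outerFactor S b T) ⬝ᵥ outerFactor S b T' =
      if T = T' then (q T : ℂ) else 0 := fun T T' => by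
    rw [star_outerFactor_dotProduct S b fun i j hij => by rw [hbb, if_neg hij]]
    simp only [hbb, if_true, q, Complex.ofReal_prod, apply_ite Complex.ofReal, Complex.ofReal_one,
      Complex.ofReal_sub]
  set A : Matrix (Finset S) (Fin n → Bool) ℂ :=
    Matrix.of fun s T => innerFactor S a T (s.map (Function.Embedding.subtype _)) with hA
  have hAA : A.conjTranspose * A = Matrix.diagonal fun T => (p T : ℂ) := by
    ext T T'
    rw [Matrix.diagonal_apply, ← hp, Matrix.mul_apply]
    simp only [Matrix.conjTranspose_apply, hA, Matrix.of_apply, dotProduct, Pi.star_apply]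
    exact sum_map_subtype S (fun s => star (innerFactor S a T s) * innerFactor S a T' s)
      fun s hs => by rw [innerFactor_eq_zero ha T' hs, mul_zero]
  -- Orthogonality of the outer factors removes the cross terms of the partial trace. The nonzero
  -- spectrum of `A * (diag q * Aᴴ)` is that of `diag q * (Aᴴ * A)`, which is `diag (q * p)`.
  have hρ : reducedDensity S (slater S fun i => a i + b i) =
      A * ((Matrix.diagonal fun T => (q T : ℂ)) * A.conjTranspose) := by
    ext s t
    have hs : ∀ (s : Finset S) (u : Finset V), u ∈ Sᶜ.powerset →
        slater S (fun i => a i + b i) (s.map (Function.Embedding.subtype _) ∪ u) =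
          ∑ T, A s T * outerFactor S b T u := by
      intro s u hu
      have hu := Finset.mem_powerset.1 hu
      have hs' : s.map (Function.Embedding.subtype _) ⊆ S := by
        intro y hy
        obtain ⟨z, _, rfl⟩ := Finset.mem_map.1 hy
        exact z.2
      have e1 : (s.map (Function.Embedding.subtype _) ∪ u) ∩ S =
          s.map (Function.Embedding.subtype _) := by
        ext y
        have h1 := @hs' y
        have h2 := @hu y
        simp only [Finset.mem_compl] at h2
        simp only [Finset.mem_inter, Finset.mem_union]
        tauto
      have e2 : (s.map (Function.Embedding.subtype _) ∪ u) \ S = u := by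
        ext y
        have h1 := @hs' y
        have h2 := @hu y
        simp only [Finset.mem_compl] at h2
        simp only [Finset.mem_sdiff, Finset.mem_union]
        tauto
      rw [slater_add_eq_sum_tensor S a b ha hb, Finset.sum_apply]
      simp only [tensor, e1, e2, hA, Matrix.of_apply]
    have hout : ∀ T T', ∑ u ∈ Sᶜ.powerset, star (outerFactor S b T u) * outerFactor S b T' u =
        if T = T' then (q T : ℂ) else 0 := by
      intro T T'
      rw [← hq]
      refine Finset.sum_subset (Finset.subset_univ _) fun u _ hu => ?_
      rw [outerFactor_eq_zero hb T' (fun h => hu (Finset.mem_powerset.2 h)), mul_zero]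
    calc reducedDensity S (slater S fun i => a i + b i) s t
        = ∑ u ∈ Sᶜ.powerset, (∑ T, A s T * outerFactor S b T u) *
            star (∑ T, A t T * outerFactor S b T u) :=
          Finset.sum_congr rfl fun u hu => by rw [hs s u hu, hs t u hu]
      _ = ∑ T, ∑ T', A s T * star (A t T') *
            ∑ u ∈ Sᶜ.powerset, star (outerFactor S b T' u) * outerFactor S b T u := by
          simp only [star_sum, star_mul', Finset.sum_mul_sum]
          rw [Finset.sum_comm]
          refine Finset.sum_congr rfl fun T _ => ?_
          rw [Finset.sum_comm]
          refine Finset.sum_congr rfl fun T' _ => ?_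
          rw [Finset.mul_sum]
          exact Finset.sum_congr rfl fun u _ => by ring
      _ = _ := by
          simp only [hout]
          rw [Matrix.mul_apply]
          refine Finset.sum_congr rfl fun T _ => ?_
          rw [Finset.sum_eq_single T (fun T' _ h => by rw [if_neg h, mul_zero]) (by simp)]
          rw [if_pos rfl, Matrix.diagonal_mul, Matrix.conjTranspose_apply]
          ring
  rw [vonNeumannEntropy_eq_sum (reducedDensity_isHermitian _ _),
    Matrix.IsHermitian.sum_eigenvalues_of_eq_mul _ A _ hρ (fun T => q T * p T) ?_ _
      Real.negMulLog_zero, ← sum_negMulLog_prod]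
  · refine Finset.sum_congr rfl fun T _ => ?_
    rw [← Finset.prod_mul_distrib]
    congr 1
    exact Finset.prod_congr rfl fun i _ => by split_ifs <;> simp
  · rw [Matrix.mul_assoc, hAA, Matrix.diagonal_mul_diagonal]
    simp

theorem vonNeumannEntropy_slater (S : Finset V) {n : ℕ} (w : Fin n → EuclideanSpace ℂ V)
    (hw : Orthonormal ℂ w) (x : Fin n → ℝ)
    (hx : ∀ i j, ∑ y ∈ S, star (w i y) * w j y = if i = j then (x i : ℂ) else 0) :
    vonNeumannEntropy (reducedDensity S (slater S w)) = ∑ i, Real.binEntropy (x i) := by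
  have hinner : ∀ i j, inner ℂ (w i) (w j) = ∑ y, star (w i y) * w j y := fun i j => by
    simp [PiLp.inner_apply, mul_comm]
  -- Cut each mode into its restrictions to `S` and to the complement; orthonormality fixes the
  -- outer Gram matrix as the identity minus the inner one.
  have h := vonNeumannEntropy_slater_add S (fun i => WithLp.toLp 2 fun y => if y ∈ S then w i y else 0)
    (fun i => WithLp.toLp 2 fun y => if y ∈ S then 0 else w i y)
    (fun i y hy => by simp [hy]) (fun i y hy => by simp [hy]) x ?_ ?_
  · rw [← h]
    congr 3
    funext i
    ext y
    by_cases hy : y ∈ S <;> simp [hy]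
  · intro i j
    rw [← hx]
    simp [PiLp.inner_apply, mul_comm, apply_ite]
  · intro i j
    have h1 := orthonormal_iff_ite.1 hw i j
    rw [hinner, ← Finset.sum_add_sum_compl S, hx] at h1
    have h2 : inner ℂ (WithLp.toLp 2 fun y => if y ∈ S then 0 else w i y : EuclideanSpace ℂ V)
        (WithLp.toLp 2 fun y => if y ∈ S then 0 else w j y) = ∑ y ∈ Sᶜ, star (w i y) * w j y := by
      simp only [PiLp.inner_apply, RCLike.inner_apply]
      rw [← Finset.sum_add_sum_compl S, Finset.sum_eq_zero, zero_add]
      · refine Finset.sum_congr rfl fun y hy => ?_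
        simp [Finset.mem_compl.1 hy, mul_comm]
      · intro y hy
        simp [hy]
    rw [h2, eq_sub_of_add_eq' h1]
    split_ifs <;> simp

/-- An orthonormal basis of `W` whose members remain orthogonal when restricted to `S`. -/
theorem exists_orthonormalBasis_diagonal (W : Submodule ℂ (EuclideanSpace ℂ V)) (S : Finset V) :
    ∃ (b : OrthonormalBasis (Fin (Module.finrank ℂ W)) ℂ W) (x : Fin (Module.finrank ℂ W) → ℝ),
      ∀ i j, ∑ y ∈ S, star ((b i : EuclideanSpace ℂ V) y) * (b j : EuclideanSpace ℂ V) y =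
        if i = j then (x i : ℂ) else 0 := by
  set D : EuclideanSpace ℂ V →ₗ[ℂ] EuclideanSpace ℂ V :=
    Matrix.toEuclideanLin (Matrix.diagonal fun y => if y ∈ S then 1 else 0)
  have hD : ∀ v w : EuclideanSpace ℂ V, inner ℂ v (D w) = ∑ y ∈ S, star (v y) * w y := by
    intro v w
    simp [D, PiLp.inner_apply, Matrix.toLpLin_apply, Matrix.mulVec_diagonal, mul_comm]
  have hD' : ∀ v w : EuclideanSpace ℂ V, inner ℂ (D v) w = inner ℂ v (D w) := by
    intro v w
    rw [← inner_conj_symm, hD, hD]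
    simp [mul_comm]
  -- The compression to `W` of the restriction `D` is symmetric; its eigenvectors are the basis
  -- sought, its eigenvalues the weights `x`.
  set T : W →ₗ[ℂ] W := W.orthogonalProjectionOnto.toLinearMap ∘ₗ D ∘ₗ W.subtype
  have hT' : ∀ v w : W, inner ℂ v (T w) = inner ℂ (v : EuclideanSpace ℂ V) (D w) := by
    intro v w
    simp [T]
  have hT : LinearMap.IsSymmetric (𝕜 := ℂ) (E := W) T := by
    intro v w
    rw [← inner_conj_symm, hT', hT', inner_conj_symm, hD']
  refine ⟨hT.eigenvectorBasis rfl, hT.eigenvalues rfl, fun i j => ?_⟩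
  rw [← hD, ← hT', hT.apply_eigenvectorBasis, inner_smul_right,
    orthonormal_iff_ite.1 (hT.eigenvectorBasis rfl).orthonormal]
  split_ifs with h
  · simp [h]
  · simp

/-- The matrix `P` is that of the orthogonal projection onto `W`. -/
structure IsProjectionMatrix (P : Matrix V V ℂ) (W : Submodule ℂ (EuclideanSpace ℂ V)) :
    Prop where
  isHermitian : P.IsHermitian
  apply_of_mem : ∀ w ∈ W, Matrix.toEuclideanLin P w = w
  apply_mem : ∀ v, Matrix.toEuclideanLin P v ∈ W

/-- Expand the projection of the unit vector at `z` in the basis: the coefficients are conjugated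
basis values at `z` because `P` is Hermitian and fixes `W`. -/
theorem IsProjectionMatrix.sum_basis {P : Matrix V V ℂ} {W : Submodule ℂ (EuclideanSpace ℂ V)}
    (hP : IsProjectionMatrix P W) {n : ℕ} (b : OrthonormalBasis (Fin n) ℂ W) (y z : V) :
    ∑ i, (b i : EuclideanSpace ℂ V) y * star ((b i : EuclideanSpace ℂ V) z) = P y z := by
  set e : EuclideanSpace ℂ V := EuclideanSpace.single z 1
  have hsym := Matrix.isSymmetric_toEuclideanLin_iff.2 hP.isHermitian
  have h := congrArg (fun w : W => (w : EuclideanSpace ℂ V) y)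
    (b.sum_repr' ⟨Matrix.toEuclideanLin P e, hP.apply_mem e⟩)
  have h2 : ∀ i, inner ℂ (b i) (⟨Matrix.toEuclideanLin P e, hP.apply_mem e⟩ : W) =
      star ((b i : EuclideanSpace ℂ V) z) := by
    intro i
    rw [Submodule.coe_inner, ← hsym, hP.apply_of_mem _ (b i).2]
    simp [e, EuclideanSpace.inner_single_right]
  simp only [h2] at h
  have h3 : Matrix.toEuclideanLin P e y = P y z := by
    simp [e, Matrix.toLpLin_apply]
  rw [← h3, ← h]
  simp [mul_comm]

/-- The entropy of a Slater state is the sum of the binary entropies of the eigenvalues of its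
correlation matrix on either of the two subsystems. -/
theorem vonNeumannEntropy_eq_sum_binEntropy {P : Matrix V V ℂ}
    {W : Submodule ℂ (EuclideanSpace ℂ V)} (hP : IsProjectionMatrix P W) {S R : Finset V}
    (hR : R = S ∨ R = Sᶜ)
    (hC : (P.submatrix (Subtype.val : R → V) (Subtype.val : R → V)).IsHermitian) :
    vonNeumannEntropy (reducedDensity S
      (slater S fun i => (stdOrthonormalBasis ℂ W i : EuclideanSpace ℂ V))) =
        ∑ i, Real.binEntropy (hC.eigenvalues i) ∧
      ∀ i, hC.eigenvalues i ∈ Set.Icc (0 : ℝ) 1 := by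
  obtain ⟨b, x, hx⟩ := exists_orthonormalBasis_diagonal W S
  have hon : Orthonormal ℂ fun i => (b i : EuclideanSpace ℂ V) :=
    b.orthonormal.comp_linearIsometry W.subtypeₗᵢ
  have htot : ∀ i j, ∑ y ∈ S, star ((b i : EuclideanSpace ℂ V) y) * (b j : EuclideanSpace ℂ V) y +
      ∑ y ∈ Sᶜ, star ((b i : EuclideanSpace ℂ V) y) * (b j : EuclideanSpace ℂ V) y =
        if i = j then 1 else 0 := by
    intro i j
    rw [Finset.sum_add_sum_compl, ← orthonormal_iff_ite.1 hon i j]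
    simp [PiLp.inner_apply, mul_comm]
  obtain ⟨x', hx', hsum⟩ : ∃ x' : Fin (Module.finrank ℂ W) → ℝ, (∀ i j, ∑ y ∈ R,
      star ((b i : EuclideanSpace ℂ V) y) * (b j : EuclideanSpace ℂ V) y =
        if i = j then (x' i : ℂ) else 0) ∧
      ∑ i, Real.binEntropy (x i) = ∑ i, Real.binEntropy (x' i) := by
    rcases hR with rfl | rfl
    · exact ⟨x, hx, rfl⟩
    -- On the complement the weights become `1 - x i`, which leaves the binary entropy unchanged.
    · refine ⟨fun i => 1 - x i, fun i j => ?_, by simp⟩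
      rw [eq_sub_of_add_eq' (htot i j), hx]
      split_ifs <;> simp
  have hrange : ∀ i, x' i ∈ Set.Icc (0 : ℝ) 1 := by
    intro i
    have e1 : ∀ Q : Finset V, ∑ y ∈ Q, star ((b i : EuclideanSpace ℂ V) y) *
        (b i : EuclideanSpace ℂ V) y = ((∑ y ∈ Q, ‖(b i : EuclideanSpace ℂ V) y‖ ^ 2 : ℝ) : ℂ) := by
      intro Q
      rw [Complex.ofReal_sum]
      refine Finset.sum_congr rfl fun y _ => ?_
      rw [mul_comm, Complex.star_def, Complex.mul_conj, Complex.normSq_eq_norm_sq]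
    have h1 := hx' i i
    have h2 := htot i i
    rw [Finset.sum_add_sum_compl, e1, if_pos rfl] at h2
    rw [e1, if_pos rfl] at h1
    have h1 : ∑ y ∈ R, ‖(b i : EuclideanSpace ℂ V) y‖ ^ 2 = x' i := by exact_mod_cast h1
    have h2 : ∑ y, ‖(b i : EuclideanSpace ℂ V) y‖ ^ 2 = 1 := by exact_mod_cast h2
    rw [← h1]
    refine ⟨by positivity, ?_⟩
    rw [← h2]
    exact Finset.sum_le_sum_of_subset_of_nonneg (Finset.subset_univ R) fun _ _ _ => by positivity
  set A : Matrix R (Fin (Module.finrank ℂ W)) ℂ :=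
    Matrix.of fun y i => (b i : EuclideanSpace ℂ V) y with hA
  have hAB : P.submatrix (Subtype.val : R → V) (Subtype.val : R → V) = A * A.conjTranspose := by
    ext y z
    rw [Matrix.submatrix_apply, ← hP.sum_basis b]
    simp [Matrix.mul_apply, hA]
  have hBA : A.conjTranspose * A = Matrix.diagonal fun i => (x' i : ℂ) := by
    ext i j
    rw [Matrix.diagonal_apply, ← hx', ← Finset.sum_coe_sort R, Matrix.mul_apply]
    simp [hA]
  have hspec := hC.sum_eigenvalues_of_eq_mul A _ hAB x' hBA
  constructor
  · obtain ⟨c, hc, hslater⟩ := exists_slater_eq_smul S b (stdOrthonormalBasis ℂ W)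
    rw [hslater, reducedDensity_smul S _ hc, vonNeumannEntropy_slater S _ hon x hx, hsum,
      hspec _ Real.binEntropy_zero]
  · classical
    -- Apply the spectral comparison to the indicator of the exterior of `[0, 1]`: it vanishes at
    -- zero and at every `x' i`, so its sum over the eigenvalues is zero.
    have h := hspec (fun t => if t ∈ Set.Icc (0 : ℝ) 1 then 0 else 1) (by simp)
    simp only [hrange, if_true, Finset.sum_const_zero] at h
    rw [Finset.sum_eq_zero_iff_of_nonneg (fun i _ => by split_ifs <;> simp)] at h
    intro i
    by_contra hi
    simpa [hi] using h i (Finset.mem_univ i)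

theorem _root_.Matrix.IsHermitian.rank_sub_smul_one {m : Type*} [Fintype m] [DecidableEq m]
    {C : Matrix m m ℂ} (hC : C.IsHermitian) (c : ℝ) :
    (C - (c : ℂ) • 1).rank = Fintype.card {i // hC.eigenvalues i ≠ c} := by
  have h : C - (c : ℂ) • 1 = Unitary.conjStarAlgAut ℂ _ hC.eigenvectorUnitary
      (Matrix.diagonal fun i => ((hC.eigenvalues i - c : ℝ) : ℂ)) := by
    conv_lhs => rw [hC.spectral_theorem]
    rw [← map_one (Unitary.conjStarAlgAut ℂ _ hC.eigenvectorUnitary), ← map_smul, ← map_sub]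
    congr 1
    ext i j
    by_cases hij : i = j
    · subst hij; simp
    · simp [hij]
  rw [h, Unitary.conjStarAlgAut_apply, ← Unitary.coe_star, Matrix.rank_mul_eq_left_of_isUnit_det,
    Matrix.rank_mul_eq_right_of_isUnit_det, Matrix.rank_diagonal]
  · refine Fintype.card_congr (Equiv.subtypeEquivRight fun i => ?_)
    rw [Ne, Complex.ofReal_eq_zero, sub_eq_zero]
  · exact Matrix.UnitaryGroup.det_isUnit _
  · exact Matrix.UnitaryGroup.det_isUnit _

/-- If the correlation matrix of one of the subsystems is a low rank perturbation of `c • 1`, then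
each of its sites contributes `binEntropy c`, up to a bounded error. -/
theorem abs_vonNeumannEntropy_sub_le {P : Matrix V V ℂ}
    {W : Submodule ℂ (EuclideanSpace ℂ V)} (hP : IsProjectionMatrix P W) {S R : Finset V}
    (hR : R = S ∨ R = Sᶜ) {c : ℝ} (hc : c ∈ Set.Icc (0 : ℝ) 1) {r : ℕ}
    (hr : (P.submatrix (Subtype.val : R → V) (Subtype.val : R → V) - (c : ℂ) • 1).rank ≤ r) :
    |vonNeumannEntropy (reducedDensity S
      (slater S fun i => (stdOrthonormalBasis ℂ W i : EuclideanSpace ℂ V))) -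
        R.card * Real.binEntropy c| ≤ r * Real.log 2 := by
  have hC := hP.isHermitian.submatrix (Subtype.val : R → V)
  obtain ⟨h1, h2⟩ := vonNeumannEntropy_eq_sum_binEntropy hP hR hC
  have hcard : (R.card : ℝ) * Real.binEntropy c = ∑ _i : R, Real.binEntropy c := by simp
  rw [h1, hcard, ← Finset.sum_sub_distrib]
  rw [hC.rank_sub_smul_one c] at hr
  classical
  calc |∑ i, (Real.binEntropy (hC.eigenvalues i) - Real.binEntropy c)|
      ≤ ∑ i, |Real.binEntropy (hC.eigenvalues i) - Real.binEntropy c| :=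
        Finset.abs_sum_le_sum_abs _ _
    -- Eigenvalues equal to `c` cancel; for the others both binary entropies lie in `[0, log 2]`.
    _ ≤ ∑ i, if hC.eigenvalues i ≠ c then Real.log 2 else 0 := by
        refine Finset.sum_le_sum fun i _ => ?_
        split_ifs with hi
        · have a1 := Real.binEntropy_nonneg (h2 i).1 (h2 i).2
          have a2 := Real.binEntropy_nonneg hc.1 hc.2
          have a3 := Real.binEntropy_le_log_two (p := hC.eigenvalues i)
          have a4 := Real.binEntropy_le_log_two (p := c)
          rw [abs_le]
          constructor <;> linarith
        · rw [not_not.1 hi]; simp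
    _ = (Fintype.card {i // hC.eigenvalues i ≠ c} : ℝ) * Real.log 2 := by
        rw [← Finset.sum_filter, Finset.sum_const, nsmul_eq_mul, Fintype.card_subtype]
    _ ≤ r * Real.log 2 := by
        have : (0 : ℝ) ≤ Real.log 2 := Real.log_nonneg (by norm_num)
        gcongr

/-- The correlation matrix of the complement is one by one, so its trace is its only eigenvalue. -/
theorem vonNeumannEntropy_eq_binEntropy {P : Matrix V V ℂ}
    {W : Submodule ℂ (EuclideanSpace ℂ V)} (hP : IsProjectionMatrix P W) {S : Finset V} {z : V}
    (hz : Sᶜ = {z}) {p : ℝ} (hp : P z z = p) :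
    vonNeumannEntropy (reducedDensity S
      (slater S fun i => (stdOrthonormalBasis ℂ W i : EuclideanSpace ℂ V))) =
        Real.binEntropy p := by
  have hC := hP.isHermitian.submatrix (Subtype.val : ({z} : Finset V) → V)
  obtain ⟨h1, -⟩ := vonNeumannEntropy_eq_sum_binEntropy hP (Or.inr hz.symm) hC
  have h2 := hC.trace_eq_sum_eigenvalues
  rw [Fintype.sum_unique] at h1
  rw [Fintype.sum_unique, Matrix.trace, Fintype.sum_unique] at h2
  rw [h1]
  congr 1
  have h3 : (p : ℂ) = hC.eigenvalues default := by
    rw [← hp]; exact h2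
  exact_mod_cast h3.symm

/-! ### Filled levels from a spectral decomposition -/

theorem toEuclideanLin_eq_smul_iff (M : Matrix V V ℂ) (c : ℂ) (v : EuclideanSpace ℂ V) :
    Matrix.toEuclideanLin M v = c • v ↔ M.mulVec v.ofLp = c • v.ofLp := by
  rw [Matrix.toLpLin_apply]
  constructor
  · intro h
    exact congrArg WithLp.ofLp h
  · intro h
    ext y
    exact congrFun h y

/-- If `E i` are the spectral projections of the adjacency matrix, for the eigenvalues
`θ 0 > θ 1 > ⋯`, then `∑ i ≤ K, E i` projects onto the filled modes. -/
theorem isProjectionMatrix_filledModes (G : SimpleGraph V) [DecidableRel G.Adj] {d : ℕ}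
    (θ : Fin d → ℝ) (hθ : StrictAnti θ) (E : Fin d → Matrix V V ℂ)
    (hE : ∀ i, (E i).IsHermitian) (hE0 : ∀ i, E i ≠ 0) (hsum : ∑ i, E i = 1)
    (hAE : ∀ i, G.adjMatrix ℂ * E i = (θ i : ℂ) • E i) (K : ℕ) :
    IsProjectionMatrix (∑ i ∈ Finset.univ.filter fun i : Fin d => (i : ℕ) ≤ K, E i)
      (filledModes G K) := by
  have hA : (G.adjMatrix ℂ).IsHermitian := by
    rw [Matrix.IsHermitian, Matrix.conjTranspose]
    ext i j
    simp [SimpleGraph.adjMatrix_apply, apply_ite]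
  have hEA : ∀ i, E i * G.adjMatrix ℂ = (θ i : ℂ) • E i := by
    intro i
    have := congrArg Matrix.conjTranspose (hAE i)
    rwa [Matrix.conjTranspose_mul, hA, hE, Matrix.conjTranspose_smul, hE, Complex.star_def,
      Complex.conj_ofReal] at this
  have hmem : ∀ (μ : ℝ) (v : EuclideanSpace ℂ V), v ∈ (hopping G).eigenspace (μ : ℂ) ↔
      (G.adjMatrix ℂ).mulVec v.ofLp = (μ : ℂ) • v.ofLp := by
    intro μ v
    rw [Module.End.mem_eigenspace_iff, hopping, toEuclideanLin_eq_smul_iff]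
  have hrange : ∀ i v, WithLp.toLp 2 ((E i).mulVec v) ∈ (hopping G).eigenspace (θ i : ℂ) := by
    intro i v
    rw [hmem, Matrix.mulVec_mulVec, hAE, Matrix.smul_mulVec]
  -- Evaluating `E i * A` on an eigenvector for `μ` in two ways gives `(θ i - μ) • E i v = 0`.
  -- Together with `∑ E i = 1` this shows that there are no eigenvalues besides the `θ i`.
  have hzero : ∀ (μ : ℝ) (v : EuclideanSpace ℂ V), v ∈ (hopping G).eigenspace (μ : ℂ) →
      ∀ i, θ i ≠ μ → (E i).mulVec v.ofLp = 0 := by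
    intro μ v hv i hi
    rw [hmem] at hv
    have h : (E i * G.adjMatrix ℂ).mulVec v.ofLp = (μ : ℂ) • (E i).mulVec v.ofLp := by
      rw [← Matrix.mulVec_mulVec, hv, Matrix.mulVec_smul]
    rw [hEA, Matrix.smul_mulVec, ← sub_eq_zero, ← sub_smul] at h
    refine (smul_eq_zero.1 h).resolve_left ?_
    exact sub_ne_zero.2 (by exact_mod_cast hi)
  have hone : ∀ v : V → ℂ, v = ∑ i, (E i).mulVec v := by
    intro v
    rw [← Matrix.sum_mulVec, hsum, Matrix.one_mulVec]
  have hfix : ∀ i (v : EuclideanSpace ℂ V), v ∈ (hopping G).eigenspace (θ i : ℂ) →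
      (E i).mulVec v.ofLp = v.ofLp := by
    intro i v hv
    conv_rhs => rw [hone v.ofLp]
    rw [Finset.sum_eq_single i (fun j _ hj => hzero _ v hv j (hθ.injective.ne hj)) (by simp)]
  have heig : ∀ μ : ℝ, (hopping G).HasEigenvalue (μ : ℂ) ↔ μ ∈ Set.range θ := by
    intro μ
    constructor
    · intro h
      obtain ⟨v, hv⟩ := h.exists_hasEigenvector
      by_contra hμ
      apply hv.2
      have h0 : v.ofLp = 0 := by
        rw [hone v.ofLp]
        exact Finset.sum_eq_zero fun i _ => hzero μ v hv.1 i fun h => hμ ⟨i, h⟩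
      ext y
      exact congrFun h0 y
    · rintro ⟨i, rfl⟩
      rw [Module.End.HasEigenvalue, Module.End.HasUnifEigenvalue]
      intro h
      apply hE0 i
      ext y z
      have := hrange i (Pi.single z 1)
      change _ ∈ (hopping G).genEigenspace _ 1 at this
      rw [h, Submodule.mem_bot] at this
      have := congrArg (fun w : EuclideanSpace ℂ V => w y) this
      simpa using this
  have hlevel : ∀ i, IsFilledLevel G K (θ i) ↔ (i : ℕ) ≤ K := by
    intro i
    -- The eigenvalues above `θ i` are the `θ j` with `j < i`, exactly `i` of them.
    have : {ν : ℝ | (hopping G).HasEigenvalue (ν : ℂ) ∧ θ i < ν} = θ '' {j | j < i} := by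
      ext ν
      simp only [Set.mem_ofPred_eq, heig, Set.mem_image]
      constructor
      · rintro ⟨⟨j, rfl⟩, h⟩
        exact ⟨j, hθ.lt_iff_gt.1 h, rfl⟩
      · rintro ⟨j, h, rfl⟩
        exact ⟨⟨j, rfl⟩, hθ h⟩
    rw [IsFilledLevel, heig, this, Set.ncard_image_of_injective _ hθ.injective]
    have : {j | j < i} = ((Finset.Iio i : Finset (Fin d)) : Set (Fin d)) := by ext; simp
    rw [this, Set.ncard_coe_finset, Fin.card_Iio]
    simp
  refine ⟨?_, ?_, ?_⟩
  · rw [Matrix.IsHermitian, Matrix.conjTranspose_sum]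
    exact Finset.sum_congr rfl fun i _ => hE i
  · intro w hw
    have hle : filledModes G K ≤
        (Matrix.toEuclideanLin (∑ i ∈ Finset.univ.filter fun i : Fin d => (i : ℕ) ≤ K, E i)).eqLocus
          LinearMap.id := by
      refine iSup₂_le fun μ hμ v hv => ?_
      obtain ⟨i, rfl⟩ := (heig μ).1 hμ.1
      rw [LinearMap.mem_eqLocus, LinearMap.id_apply, Matrix.toLpLin_apply, Matrix.sum_mulVec,
        Finset.sum_eq_single i (fun j _ hj => hzero _ v hv j (hθ.injective.ne hj)), hfix i v hv]
      intro h
      simp [(hlevel i).1 hμ] at h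
    exact hle hw
  · intro v
    rw [Matrix.toLpLin_apply, Matrix.sum_mulVec, WithLp.toLp_sum]
    refine Submodule.sum_mem _ fun i hi => ?_
    have hi : (i : ℕ) ≤ K := by simpa using hi
    exact (le_iSup₂_of_le (θ i) ((hlevel i).2 hi) le_rfl :
      (hopping G).eigenspace (θ i : ℂ) ≤ filledModes G K) (hrange i _)

end FreeFermion

/-! ### Spectral decomposition of Hadamard graphs -/

namespace HadamardGraph

variable {n : ℕ}

/-- The matrix `M` acting on functions that change sign with the sign of the index. -/
def oddBlock (M : Matrix (Fin n) (Fin n) ℤ) : Matrix (Fin n × ℤˣ) (Fin n × ℤˣ) ℂ :=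
  Matrix.of fun a b => (M a.1 b.1 : ℂ) * ((a.2 : ℤ) : ℂ) * ((b.2 : ℤ) : ℂ) / 2

/-- The all-one matrix. -/
def onesBlock (n : ℕ) : Matrix (Fin n × ℤˣ) (Fin n × ℤˣ) ℂ := Matrix.of fun _ _ => 1

theorem sum_units_int {M : Type*} [AddCommMonoid M] (f : ℤˣ → M) : ∑ ε, f ε = f 1 + f (-1) := by
  rw [UnitsInt.univ, Finset.sum_pair (by decide)]

/-- The sum over the intermediate sign gives a factor 2, which the normalization by `1/2` absorbs.
-/
theorem oddBlock_mul (M N : Matrix (Fin n) (Fin n) ℤ) :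
    oddBlock M * oddBlock N = oddBlock (M * N) := by
  ext a b
  simp only [oddBlock, Matrix.mul_apply, Matrix.of_apply, Fintype.sum_prod_type, sum_units_int]
  push_cast
  rw [Finset.sum_mul, Finset.sum_mul, Finset.sum_div]
  refine Finset.sum_congr rfl fun j _ => ?_
  ring

theorem oddBlock_conjTranspose (M : Matrix (Fin n) (Fin n) ℤ) :
    (oddBlock M).conjTranspose = oddBlock M.transpose := by
  ext a b
  simp only [oddBlock, Matrix.transpose_apply, Matrix.conjTranspose_apply, Matrix.of_apply,
    Complex.star_def, map_div₀, map_mul, map_intCast, Complex.conj_ofNat]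
  ring

theorem oddBlock_natCast_smul (c : ℕ) (M : Matrix (Fin n) (Fin n) ℤ) :
    oddBlock ((c : ℤ) • M) = (c : ℂ) • oddBlock M := by
  ext a b
  simp only [oddBlock, Matrix.smul_apply, Matrix.of_apply, smul_eq_mul]
  push_cast
  ring

theorem oddBlock_mul_onesBlock (M : Matrix (Fin n) (Fin n) ℤ) : oddBlock M * onesBlock n = 0 := by
  ext a b
  simp only [oddBlock, onesBlock, Matrix.mul_apply, Fintype.sum_prod_type, sum_units_int,
    Matrix.of_apply]
  refine Finset.sum_eq_zero fun j _ => ?_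
  push_cast
  ring

theorem onesBlock_conjTranspose : (onesBlock n).conjTranspose = onesBlock n := by
  ext a b
  simp [onesBlock]

theorem onesBlock_mul_oddBlock (M : Matrix (Fin n) (Fin n) ℤ) : onesBlock n * oddBlock M = 0 := by
  have := congrArg Matrix.conjTranspose (oddBlock_mul_onesBlock M.transpose)
  rwa [Matrix.conjTranspose_mul, onesBlock_conjTranspose, oddBlock_conjTranspose,
    Matrix.transpose_transpose, Matrix.conjTranspose_zero] at this

theorem onesBlock_mul_self : onesBlock n * onesBlock n = (2 * n : ℂ) • onesBlock n := by
  ext a b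
  simp [onesBlock, Matrix.mul_apply, mul_comm]

/-- The all-one matrix. -/
def ones (n : ℕ) : Matrix (HadamardVertex n) (HadamardVertex n) ℂ :=
  Matrix.fromBlocks (onesBlock n) (onesBlock n) (onesBlock n) (onesBlock n)

/-- The matrix that is `1` within the parts of the graph and `-1` between them. -/
def partSigns (n : ℕ) : Matrix (HadamardVertex n) (HadamardVertex n) ℂ :=
  Matrix.fromBlocks (onesBlock n) (-onesBlock n) (-onesBlock n) (onesBlock n)

/-- The projection onto the functions that change sign under the antipodal map. -/
def odd (n : ℕ) : Matrix (HadamardVertex n) (HadamardVertex n) ℂ :=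
  Matrix.fromBlocks (oddBlock 1) 0 0 (oddBlock 1)

/-- The adjacency matrix, restricted to the functions that change sign under the antipodal map. -/
def oddAdj (H : Matrix (Fin n) (Fin n) ℤ) : Matrix (HadamardVertex n) (HadamardVertex n) ℂ :=
  Matrix.fromBlocks 0 (oddBlock H) (oddBlock H.transpose) 0

theorem ones_mul_ones : ones n * ones n = (4 * n : ℂ) • ones n := by
  simp only [ones, Matrix.fromBlocks_multiply, onesBlock_mul_self, ← add_smul,
    Matrix.fromBlocks_smul]
  ring_nf

theorem partSigns_mul_partSigns : partSigns n * partSigns n = (4 * n : ℂ) • partSigns n := by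
  simp only [partSigns, Matrix.fromBlocks_multiply, onesBlock_mul_self, ← add_smul,
    Matrix.fromBlocks_smul, Matrix.neg_mul, Matrix.mul_neg, neg_neg, smul_neg, ← neg_add]
  ring_nf

theorem ones_mul_partSigns : ones n * partSigns n = 0 := by
  simp [ones, partSigns, Matrix.fromBlocks_multiply]

theorem partSigns_mul_ones : partSigns n * ones n = 0 := by
  simp [ones, partSigns, Matrix.fromBlocks_multiply]

theorem ones_mul_odd : ones n * odd n = 0 := by
  simp [ones, odd, Matrix.fromBlocks_multiply, onesBlock_mul_oddBlock]

theorem partSigns_mul_odd : partSigns n * odd n = 0 := by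
  simp [partSigns, odd, Matrix.fromBlocks_multiply, onesBlock_mul_oddBlock]

theorem ones_mul_oddAdj (H : Matrix (Fin n) (Fin n) ℤ) : ones n * oddAdj H = 0 := by
  simp [ones, oddAdj, Matrix.fromBlocks_multiply, onesBlock_mul_oddBlock]

theorem partSigns_mul_oddAdj (H : Matrix (Fin n) (Fin n) ℤ) : partSigns n * oddAdj H = 0 := by
  simp [partSigns, oddAdj, Matrix.fromBlocks_multiply, onesBlock_mul_oddBlock]

theorem oddAdj_mul_ones (H : Matrix (Fin n) (Fin n) ℤ) : oddAdj H * ones n = 0 := by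
  simp [ones, oddAdj, Matrix.fromBlocks_multiply, oddBlock_mul_onesBlock]

theorem oddAdj_mul_partSigns (H : Matrix (Fin n) (Fin n) ℤ) : oddAdj H * partSigns n = 0 := by
  simp [partSigns, oddAdj, Matrix.fromBlocks_multiply, oddBlock_mul_onesBlock]

theorem oddAdj_mul_odd (H : Matrix (Fin n) (Fin n) ℤ) : oddAdj H * odd n = oddAdj H := by
  simp [odd, oddAdj, Matrix.fromBlocks_multiply, oddBlock_mul]

theorem mul_transpose_of_isHadamard {H : Matrix (Fin n) (Fin n) ℤ} (hH : H.IsHadamard) :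
    H * H.transpose = (n : ℤ) • 1 := by
  have := hH.mul_conjTranspose
  rwa [Matrix.conjTranspose_eq_transpose_of_trivial, Fintype.card_fin] at this

theorem transpose_mul_of_isHadamard {H : Matrix (Fin n) (Fin n) ℤ} (hH : H.IsHadamard) :
    H.transpose * H = (n : ℤ) • 1 := by
  have := hH.conjTranspose_mul
  rwa [Matrix.conjTranspose_eq_transpose_of_trivial, Fintype.card_fin] at this

theorem eq_one_or_neg_one_of_isHadamard {H : Matrix (Fin n) (Fin n) ℤ} (hH : H.IsHadamard)
    (i j : Fin n) : H i j = 1 ∨ H i j = -1 := by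
  have := Unitary.star_mul_self_of_mem (hH.apply_mem i j)
  rw [star_trivial] at this
  exact mul_self_eq_one_iff.1 this

theorem oddAdj_mul_oddAdj {H : Matrix (Fin n) (Fin n) ℤ} (hH : H.IsHadamard) :
    oddAdj H * oddAdj H = (n : ℂ) • odd n := by
  simp only [odd, oddAdj, Matrix.fromBlocks_multiply, oddBlock_mul,
    mul_transpose_of_isHadamard hH, transpose_mul_of_isHadamard hH, oddBlock_natCast_smul,
    Matrix.fromBlocks_smul, mul_zero, zero_mul, add_zero, zero_add, smul_zero]

theorem adj_inl_inr (H : Matrix (Fin n) (Fin n) ℤ) (i j : Fin n) (ε δ : ℤˣ) :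
    (hadamardGraph H).Adj (Sum.inl (i, ε)) (Sum.inr (j, δ)) ↔ H i j = ((ε * δ : ℤˣ) : ℤ) :=
  Iff.rfl

theorem adj_inr_inl (H : Matrix (Fin n) (Fin n) ℤ) (i j : Fin n) (ε δ : ℤˣ) :
    (hadamardGraph H).Adj (Sum.inr (j, δ)) (Sum.inl (i, ε)) ↔ H i j = ((ε * δ : ℤˣ) : ℤ) :=
  Iff.rfl

theorem not_adj_inl_inl (H : Matrix (Fin n) (Fin n) ℤ) (a b : Fin n × ℤˣ) :
    ¬ (hadamardGraph H).Adj (Sum.inl a) (Sum.inl b) := fun h => h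

theorem not_adj_inr_inr (H : Matrix (Fin n) (Fin n) ℤ) (a b : Fin n × ℤˣ) :
    ¬ (hadamardGraph H).Adj (Sum.inr a) (Sum.inr b) := fun h => h

/-- For signs, the indicator of `H i j = ε δ` is `(1 + H i j ε δ) / 2`. The constant half sits in
the off-diagonal blocks, where `ones - partSigns` equals 2. -/
theorem adjMatrix_eq {H : Matrix (Fin n) (Fin n) ℤ} (hH : H.IsHadamard) :
    (hadamardGraph H).adjMatrix ℂ =
      (4⁻¹ : ℂ) • ones n - (4⁻¹ : ℂ) • partSigns n + oddAdj H := by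
  have key : ∀ (i j : Fin n) (ε δ : ℤˣ), (if H i j = ((ε * δ : ℤˣ) : ℤ) then (1 : ℂ) else 0) =
      2⁻¹ + (H i j : ℂ) * ((ε : ℤ) : ℂ) * ((δ : ℤ) : ℂ) / 2 := by
    intro i j ε δ
    rcases eq_one_or_neg_one_of_isHadamard hH i j with h | h <;>
    rcases Int.units_eq_one_or ε with rfl | rfl <;>
    rcases Int.units_eq_one_or δ with rfl | rfl <;> rw [h] <;> norm_num
  ext (⟨i, ε⟩ | ⟨i, ε⟩) (⟨j, δ⟩ | ⟨j, δ⟩)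
  · rw [SimpleGraph.adjMatrix_apply, if_neg (not_adj_inl_inl H _ _)]
    simp [ones, partSigns, oddAdj]
  · rw [SimpleGraph.adjMatrix_apply]
    simp only [adj_inl_inr, key]
    simp [ones, partSigns, oddAdj, oddBlock, onesBlock]
    norm_num
  · rw [SimpleGraph.adjMatrix_apply]
    simp only [adj_inr_inl, key]
    simp [ones, partSigns, oddAdj, oddBlock, onesBlock]
    ring
  · rw [SimpleGraph.adjMatrix_apply, if_neg (not_adj_inr_inr H _ _)]
    simp [ones, partSigns, oddAdj]

/-- The eigenvalues of the adjacency matrix. -/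
def level (n : ℕ) : Fin 5 → ℝ := ![n, √n, 0, -√n, -n]

/-- The spectral projections of the adjacency matrix. -/
def spectralProjection (H : Matrix (Fin n) (Fin n) ℤ) :
    Fin 5 → Matrix (HadamardVertex n) (HadamardVertex n) ℂ :=
  ![(4 * n : ℂ)⁻¹ • ones n,
    (2⁻¹ : ℂ) • odd n + (2 * (√n : ℝ) : ℂ)⁻¹ • oddAdj H,
    1 - odd n - (4 * n : ℂ)⁻¹ • ones n - (4 * n : ℂ)⁻¹ • partSigns n,
    (2⁻¹ : ℂ) • odd n - (2 * (√n : ℝ) : ℂ)⁻¹ • oddAdj H,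
    (4 * n : ℂ)⁻¹ • partSigns n]

theorem level_strictAnti (hn : 2 ≤ n) : StrictAnti (level n) := by
  have h2 : (2 : ℝ) ≤ n := by exact_mod_cast hn
  have h0 : 0 < √(n : ℝ) := Real.sqrt_pos.2 (by linarith)
  have h1 : √(n : ℝ) < n := by
    rw [Real.sqrt_lt' (by linarith)]
    nlinarith
  rw [Fin.strictAnti_iff_succ_lt]
  intro i
  fin_cases i <;> simp [level] <;> linarith

theorem sum_spectralProjection (H : Matrix (Fin n) (Fin n) ℤ) :
    ∑ i, spectralProjection H i = 1 := by
  simp only [Fin.sum_univ_five, spectralProjection]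
  simp
  module

theorem ones_isHermitian : (ones n).IsHermitian := by
  simp [ones, Matrix.IsHermitian, Matrix.fromBlocks_conjTranspose, onesBlock_conjTranspose]

theorem partSigns_isHermitian : (partSigns n).IsHermitian := by
  simp [partSigns, Matrix.IsHermitian, Matrix.fromBlocks_conjTranspose, onesBlock_conjTranspose]

theorem odd_isHermitian : (odd n).IsHermitian := by
  simp [odd, Matrix.IsHermitian, Matrix.fromBlocks_conjTranspose, oddBlock_conjTranspose]

theorem oddAdj_isHermitian (H : Matrix (Fin n) (Fin n) ℤ) : (oddAdj H).IsHermitian := by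
  simp [oddAdj, Matrix.IsHermitian, Matrix.fromBlocks_conjTranspose, oddBlock_conjTranspose]

theorem spectralProjection_isHermitian (H : Matrix (Fin n) (Fin n) ℤ) (i : Fin 5) :
    (spectralProjection H i).IsHermitian := by
  have h1 := (ones_isHermitian (n := n)).eq
  have h2 := (partSigns_isHermitian (n := n)).eq
  have h3 := (odd_isHermitian (n := n)).eq
  have h4 := (oddAdj_isHermitian H).eq
  fin_cases i <;> simp [spectralProjection, Matrix.IsHermitian, Matrix.conjTranspose_smul,
    h1, h2, h3, h4]

theorem adjMatrix_mul_spectralProjection {H : Matrix (Fin n) (Fin n) ℤ} (hH : H.IsHadamard)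
    (hn : n ≠ 0) (i : Fin 5) :
    (hadamardGraph H).adjMatrix ℂ * spectralProjection H i =
      (level n i : ℂ) • spectralProjection H i := by
  have hn' : (n : ℂ) ≠ 0 := by exact_mod_cast hn
  have hs : ((√n : ℝ) : ℂ) * ((√n : ℝ) : ℂ) = n := by
    rw [← Complex.ofReal_mul, Real.mul_self_sqrt (by positivity)]
    simp
  have hs0 : ((√n : ℝ) : ℂ) ≠ 0 := fun h => hn' (by rw [← hs, h, mul_zero])
  have e1 : (n : ℂ)⁻¹ * 4⁻¹ * n = 4⁻¹ := by field_simp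
  have e2 : (n : ℂ) * ((n : ℂ)⁻¹ * 4⁻¹) = 4⁻¹ := by field_simp
  have e3 : ((√n : ℝ) : ℂ)⁻¹ * 2⁻¹ * n = (√n : ℝ) * 2⁻¹ := by
    rw [← hs]; field_simp
  have e4 : ((√n : ℝ) : ℂ) * (((√n : ℝ) : ℂ)⁻¹ * 2⁻¹) = 2⁻¹ := by field_simp
  rw [adjMatrix_eq hH]
  fin_cases i <;> simp [spectralProjection, level, add_mul, sub_mul, mul_add, mul_sub,
    ones_mul_ones, partSigns_mul_partSigns, oddAdj_mul_oddAdj hH, ones_mul_partSigns, partSigns_mul_ones, ones_mul_odd,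
    partSigns_mul_odd, ones_mul_oddAdj, partSigns_mul_oddAdj, oddAdj_mul_ones,
    oddAdj_mul_partSigns, oddAdj_mul_odd, smul_smul]
  · rw [e1, e2]
  · rw [e3, e4, add_comm]
  · rw [e1]; abel
  · calc _ = (((√n : ℝ) : ℂ) * (((√n : ℝ) : ℂ)⁻¹ * 2⁻¹)) • oddAdj H -
          (((√n : ℝ) : ℂ) * 2⁻¹) • odd n := by rw [e3, e4]
      _ = _ := by module
  · rw [e1, e2]

end HadamardGraph

/-! ### Balls in Hadamard graphs -/

theorem SimpleGraph.edist_le_succ_iff {V : Type*} (G : SimpleGraph V) (u v : V) (k : ℕ) :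
    G.edist u v ≤ (k + 1 : ℕ) ↔ ∃ w, (u = w ∨ G.Adj u w) ∧ G.edist w v ≤ k := by
  constructor
  · intro h
    obtain ⟨p, hp⟩ := G.exists_walk_of_edist_ne_top (ne_top_of_le_ne_top (ENat.natCast_ne_top _) h)
    rw [← hp] at h
    cases p with
    | nil => exact ⟨u, Or.inl rfl, by simp⟩
    | cons hadj q =>
      refine ⟨_, Or.inr hadj, (G.edist_le q).trans ?_⟩
      rw [SimpleGraph.Walk.length_cons] at h
      exact_mod_cast Nat.le_of_succ_le_succ (by exact_mod_cast h)
  · rintro ⟨w, rfl | hw, h⟩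
    · exact h.trans (by exact_mod_cast Nat.le_succ k)
    · calc G.edist u v ≤ G.edist u w + G.edist w v := G.edist_triangle
        _ ≤ 1 + k := add_le_add (SimpleGraph.edist_eq_one_iff_adj.2 hw).le h
        _ = (k + 1 : ℕ) := by rw [add_comm]; rfl

namespace HadamardGraph

variable {n : ℕ}

/-- The antipode of a vertex, at distance four. -/
def antipode : HadamardVertex n → HadamardVertex n
  | Sum.inl (i, ε) => Sum.inl (i, -ε)
  | Sum.inr (j, δ) => Sum.inr (j, -δ)

theorem antipode_antipode (v : HadamardVertex n) : antipode (antipode v) = v := by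
  rcases v with ⟨i, ε⟩ | ⟨i, ε⟩ <;> simp [antipode]

theorem isLeft_antipode (v : HadamardVertex n) : (antipode v).isLeft = v.isLeft := by
  rcases v with ⟨i, ε⟩ | ⟨i, ε⟩ <;> simp [antipode]

theorem antipode_ne (v : HadamardVertex n) : antipode v ≠ v := by
  rcases v with ⟨i, ε⟩ | ⟨i, ε⟩ <;> rcases Int.units_eq_one_or ε with rfl | rfl <;>
    simp [antipode]

variable {H : Matrix (Fin n) (Fin n) ℤ}

theorem isLeft_ne_of_adj {v w : HadamardVertex n} (h : (hadamardGraph H).Adj v w) :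
    v.isLeft ≠ w.isLeft := by
  rcases v with v | v <;> rcases w with w | w
  · exact (not_adj_inl_inl H _ _ h).elim
  · simp
  · simp
  · exact (not_adj_inr_inr H _ _ h).elim

theorem adj_antipode_iff (hH : H.IsHadamard) {v w : HadamardVertex n} (h : v.isLeft ≠ w.isLeft) :
    (hadamardGraph H).Adj (antipode v) w ↔ ¬ (hadamardGraph H).Adj v w := by
  rcases v with ⟨i, ε⟩ | ⟨i, ε⟩ <;> rcases w with ⟨j, δ⟩ | ⟨j, δ⟩
  · simp at h
  · rw [antipode, adj_inl_inr, adj_inl_inr]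
    rcases eq_one_or_neg_one_of_isHadamard hH i j with h' | h' <;>
    rcases Int.units_eq_one_or ε with rfl | rfl <;>
    rcases Int.units_eq_one_or δ with rfl | rfl <;> rw [h'] <;> decide
  · rw [antipode, adj_inr_inl, adj_inr_inl]
    rcases eq_one_or_neg_one_of_isHadamard hH j i with h' | h' <;>
    rcases Int.units_eq_one_or ε with rfl | rfl <;>
    rcases Int.units_eq_one_or δ with rfl | rfl <;> rw [h'] <;> decide
  · simp at h

theorem exists_unit_eq (hH : H.IsHadamard) (i j : Fin n) : ∃ u : ℤˣ, H i j = u := by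
  rcases eq_one_or_neg_one_of_isHadamard hH i j with h | h
  · exact ⟨1, by simp [h]⟩
  · exact ⟨-1, by simp [h]⟩

/-- For distinct rows, failure at every column would make all products `H i j * H k j` equal to `-ε
ε'`, so that the rows could not be orthogonal. -/
theorem exists_entry_eq (hH : H.IsHadamard) {i k : Fin n} {ε ε' : ℤˣ} (h : (k, ε') ≠ (i, -ε)) :
    ∃ j, ∃ δ : ℤˣ, H i j = ((ε * δ : ℤˣ) : ℤ) ∧ H k j = ((ε' * δ : ℤˣ) : ℤ) := by
  choose u hu using exists_unit_eq hH
  by_cases hik : i = k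
  · subst hik
    have hε : ε' = ε := by
      rcases Int.units_eq_one_or ε with rfl | rfl <;>
      rcases Int.units_eq_one_or ε' with rfl | rfl <;> simp_all
    subst hε
    refine ⟨i, ε' * u i i, ?_⟩
    rw [← mul_assoc, Int.units_mul_self, one_mul, hu]
    simp
  · by_contra! hne
    have hprod : ∀ j, u i j * u k j = -(ε * ε') := by
      intro j
      have h1 := hne j (ε * u i j)
      rw [← mul_assoc, Int.units_mul_self, one_mul, hu, hu] at h1
      have h2 : u k j ≠ ε' * (ε * u i j) := fun h => h1 rfl (congrArg Units.val h)
      revert h2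
      rcases Int.units_eq_one_or ε with rfl | rfl <;>
      rcases Int.units_eq_one_or ε' with rfl | rfl <;>
      rcases Int.units_eq_one_or (u i j) with h | h <;>
      rcases Int.units_eq_one_or (u k j) with h' | h' <;> rw [h, h'] <;> decide
    have h0 := congrFun (congrFun (mul_transpose_of_isHadamard hH) i) k
    simp only [Matrix.mul_apply, Matrix.transpose_apply, hu, Matrix.smul_apply,
      Matrix.one_apply_ne hik, smul_zero, ← Units.val_mul, hprod, Finset.sum_const,
      Finset.card_univ, Fintype.card_fin, nsmul_eq_mul] at h0
    rcases mul_eq_zero.1 h0 with h | h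
    · have : n = 0 := by exact_mod_cast h
      subst this
      exact i.elim0
    · exact Units.ne_zero _ h

theorem isHadamard_transpose (hH : H.IsHadamard) : H.transpose.IsHadamard := by
  have := hH.conjTranspose
  rwa [Matrix.conjTranspose_eq_transpose_of_trivial] at this

theorem exists_common_neighbor (hH : H.IsHadamard) {v w : HadamardVertex n}
    (h : v.isLeft = w.isLeft) (hvw : w ≠ antipode v) :
    ∃ z, (hadamardGraph H).Adj v z ∧ (hadamardGraph H).Adj z w := by
  rcases v with ⟨i, ε⟩ | ⟨i, ε⟩ <;> rcases w with ⟨k, ε'⟩ | ⟨k, ε'⟩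
  · obtain ⟨j, δ, h1, h2⟩ := exists_entry_eq hH (fun h => hvw (congrArg Sum.inl h))
    exact ⟨Sum.inr (j, δ), h1, h2⟩
  · simp at h
  · simp at h
  · obtain ⟨j, δ, h1, h2⟩ := exists_entry_eq (isHadamard_transpose hH)
      (fun h => hvw (congrArg Sum.inr h))
    refine ⟨Sum.inl (j, δ), ?_, ?_⟩
    · rw [adj_inr_inl, mul_comm]; exact h1
    · rw [adj_inl_inr, mul_comm]; exact h2

theorem exists_adj_ne (hH : H.IsHadamard) (hn : 2 ≤ n) (v w : HadamardVertex n) :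
    ∃ z, (hadamardGraph H).Adj v z ∧ z ≠ w := by
  have : Nontrivial (Fin n) := Fin.nontrivial_iff_two_le.2 hn
  have hidx : ∃ j : Fin n, ∀ ε : ℤˣ, w ≠ Sum.inl (j, ε) ∧ w ≠ Sum.inr (j, ε) := by
    rcases w with ⟨i, ε⟩ | ⟨i, ε⟩ <;> obtain ⟨j, hj⟩ := exists_ne i <;>
      exact ⟨j, fun ε => by simp [hj.symm]⟩
  obtain ⟨j, hj⟩ := hidx
  rcases v with ⟨i, ε⟩ | ⟨i, ε⟩
  · obtain ⟨u, hu⟩ := exists_unit_eq hH i j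
    refine ⟨Sum.inr (j, ε * u), ?_, (hj _).2.symm⟩
    rw [adj_inl_inr, ← mul_assoc, Int.units_mul_self, one_mul, hu]
  · obtain ⟨u, hu⟩ := exists_unit_eq hH j i
    refine ⟨Sum.inl (j, u * ε), ?_, (hj _).1.symm⟩
    rw [adj_inr_inl, mul_assoc, Int.units_mul_self, mul_one, hu]

theorem edist_le_one_iff (v w : HadamardVertex n) :
    (hadamardGraph H).edist v w ≤ (1 : ℕ) ↔ w = v ∨ (hadamardGraph H).Adj v w := by
  rw [Nat.cast_one, SimpleGraph.edist_le_one_iff_adj_or_eq, or_comm, eq_comm]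

/-- Two vertices of the same part have a common neighbour unless antipodal; for vertices in
different parts, being adjacent to `v` and to its antipode are complementary. -/
theorem edist_le_two_iff (hH : H.IsHadamard) (v w : HadamardVertex n) :
    (hadamardGraph H).edist v w ≤ (2 : ℕ) ↔
      ¬ (w = antipode v ∨ (hadamardGraph H).Adj (antipode v) w) := by
  rw [SimpleGraph.edist_le_succ_iff]
  simp only [edist_le_one_iff]
  constructor
  -- Each case contradicts `antipode_ne`, the bipartition, or `adj_antipode_iff`.
  · rintro ⟨z, rfl | hz, rfl | hw⟩ (h | h)
    · exact antipode_ne _ h.symm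
    · exact isLeft_ne_of_adj h (isLeft_antipode _)
    · have := isLeft_ne_of_adj hw
      rw [h, isLeft_antipode] at this
      exact this rfl
    · exact (adj_antipode_iff hH (isLeft_ne_of_adj hw)).1 h hw
    · have := isLeft_ne_of_adj hz
      rw [h, isLeft_antipode] at this
      exact this rfl
    · exact (adj_antipode_iff hH (isLeft_ne_of_adj hz)).1 h hz
    · rw [h] at hw
      exact (adj_antipode_iff hH (isLeft_ne_of_adj hz)).1 hw.symm hz
    · have h1 := isLeft_ne_of_adj hz
      have h2 := isLeft_ne_of_adj hw
      have h3 := isLeft_ne_of_adj h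
      rw [isLeft_antipode] at h3
      revert h1 h2 h3
      cases v.isLeft <;> cases z.isLeft <;> cases w.isLeft <;> simp
  · intro h
    push Not at h
    by_cases hp : v.isLeft = w.isLeft
    · obtain ⟨z, h1, h2⟩ := exists_common_neighbor hH hp h.1
      exact ⟨z, Or.inr h1, Or.inr h2⟩
    · have := h.2
      rw [adj_antipode_iff hH hp, not_not] at this
      exact ⟨v, Or.inl rfl, Or.inr this⟩

theorem edist_le_three_iff (hH : H.IsHadamard) (hn : 2 ≤ n) (v w : HadamardVertex n) :
    (hadamardGraph H).edist v w ≤ (3 : ℕ) ↔ w ≠ antipode v := by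
  rw [SimpleGraph.edist_le_succ_iff]
  simp only [edist_le_two_iff hH]
  constructor
  · rintro ⟨z, rfl | hz, h⟩ rfl
    · simp at h
    · push Not at h
      have h2 := isLeft_ne_of_adj hz
      have := h.2
      rw [adj_antipode_iff hH (by rw [isLeft_antipode]; exact h2.symm), not_not] at this
      exact (adj_antipode_iff hH h2).1 this.symm hz
  · intro h
    by_cases hp : v.isLeft = w.isLeft
    · refine ⟨v, Or.inl rfl, ?_⟩
      push Not
      refine ⟨h, fun h' => isLeft_ne_of_adj h' ?_⟩
      rw [isLeft_antipode, hp]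
    · obtain ⟨z, hz, hzw⟩ := exists_adj_ne hH hn v (antipode w)
      have h1 := isLeft_ne_of_adj hz
      refine ⟨z, Or.inr hz, ?_⟩
      push Not
      refine ⟨fun h' => hzw (by rw [h', antipode_antipode]), fun h' => ?_⟩
      have h2 := isLeft_ne_of_adj h'
      rw [isLeft_antipode] at h2
      revert h1 h2 hp
      cases v.isLeft <;> cases z.isLeft <;> cases w.isLeft <;> simp

open FreeFermion

theorem mem_distBall (v w : HadamardVertex n) (l : ℕ) :
    w ∈ distBall (hadamardGraph H) v l ↔ (hadamardGraph H).edist v w ≤ l := by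
  simp [distBall]

theorem mem_distBall_one (v w : HadamardVertex n) :
    w ∈ distBall (hadamardGraph H) v 1 ↔ w = v ∨ (hadamardGraph H).Adj v w := by
  rw [mem_distBall, edist_le_one_iff]

theorem compl_distBall_two (hH : H.IsHadamard) (v : HadamardVertex n) :
    (distBall (hadamardGraph H) v 2)ᶜ = distBall (hadamardGraph H) (antipode v) 1 := by
  ext w
  rw [Finset.mem_compl, mem_distBall, edist_le_two_iff hH, not_not, mem_distBall_one]

theorem compl_distBall_three (hH : H.IsHadamard) (hn : 2 ≤ n) (v : HadamardVertex n) :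
    (distBall (hadamardGraph H) v 3)ᶜ = {antipode v} := by
  ext w
  rw [Finset.mem_compl, mem_distBall, edist_le_three_iff hH hn, not_not, Finset.mem_singleton]

/-- The degree is a row sum of the adjacency matrix, and only the first term of `adjMatrix_eq` acts
nontrivially on `ones`. -/
theorem degree_eq (hH : H.IsHadamard) (v : HadamardVertex n) : (hadamardGraph H).degree v = n := by
  have h : (hadamardGraph H).adjMatrix ℂ * ones n = (n : ℂ) • ones n := by
    rw [adjMatrix_eq hH, add_mul, sub_mul, smul_mul_assoc, smul_mul_assoc, ones_mul_ones,
      partSigns_mul_ones, oddAdj_mul_ones, smul_smul]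
    simp
  have h1 : ∀ v w : HadamardVertex n, ones n v w = 1 := by
    rintro (v | v) (w | w) <;> simp [ones, onesBlock]
  have h2 := congrFun (congrFun h v) v
  simp only [Matrix.mul_apply, h1, mul_one, Matrix.smul_apply, smul_eq_mul] at h2
  have h3 := (hadamardGraph H).adjMatrix_mulVec_const_apply (α := ℂ) (a := 1) (v := v)
  simp only [Matrix.mulVec, dotProduct, Function.const_apply, mul_one] at h3
  rw [h2] at h3
  exact_mod_cast h3.symm

theorem card_distBall_one (hH : H.IsHadamard) (v : HadamardVertex n) :
    (distBall (hadamardGraph H) v 1).card = n + 1 := by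
  have : distBall (hadamardGraph H) v 1 = insert v ((hadamardGraph H).neighborFinset v) := by
    ext w
    rw [mem_distBall_one]
    simp
  rw [this, Finset.card_insert_of_notMem (by simp), SimpleGraph.card_neighborFinset_eq_degree,
    degree_eq hH]

end HadamardGraph

/-! ### Entropies of balls in Hadamard graphs -/

theorem Matrix.rank_le_of_eq_sum {m : Type*} [Fintype m] {r : ℕ} (M : Matrix m m ℂ)
    (a b : Fin r → m → ℂ) (h : ∀ v w, M v w = ∑ k, a k v * b k w) : M.rank ≤ r := by
  have : M = (Matrix.of fun v k => a k v : Matrix m (Fin r) ℂ) * Matrix.of b := by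
    ext v w
    rw [h, Matrix.mul_apply]
    rfl
  rw [this]
  exact (Matrix.rank_mul_le_left _ _).trans ((Matrix.rank_le_card_width _).trans (by simp))

namespace HadamardGraph

open FreeFermion

variable {n : ℕ} {H : Matrix (Fin n) (Fin n) ℤ}

/-! ### Entries of the spectral projections, on the diagonal and on balls of radius one -/

theorem onesBlock_apply (a b : Fin n × ℤˣ) : onesBlock n a b = 1 := rfl

theorem ones_apply (v w : HadamardVertex n) : ones n v w = 1 := by
  rcases v with v | v <;> rcases w with w | w <;> simp [ones, onesBlock_apply]

theorem partSigns_apply (v w : HadamardVertex n) :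
    partSigns n v w = (if v.isLeft then 1 else -1) * (if w.isLeft then 1 else -1) := by
  rcases v with v | v <;> rcases w with w | w <;> simp [partSigns, onesBlock_apply]

theorem oddBlock_one_apply_self (a : Fin n × ℤˣ) : oddBlock 1 a a = 2⁻¹ := by
  rcases a with ⟨i, ε⟩
  rcases Int.units_eq_one_or ε with rfl | rfl <;> simp [oddBlock]

theorem odd_apply_self (v : HadamardVertex n) : odd n v v = 2⁻¹ := by
  rcases v with v | v <;> simp [odd, oddBlock_one_apply_self]

theorem oddAdj_apply_of_isLeft_eq {v w : HadamardVertex n} (h : v.isLeft = w.isLeft) :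
    oddAdj H v w = 0 := by
  rcases v with v | v <;> rcases w with w | w <;> simp_all [oddAdj]

theorem oddAdj_apply_self (v : HadamardVertex n) : oddAdj H v v = 0 :=
  oddAdj_apply_of_isLeft_eq rfl

theorem partSigns_apply_self (v : HadamardVertex n) : partSigns n v v = 1 := by
  rw [partSigns_apply]
  split_ifs <;> simp

theorem odd_apply_of_ne {v w : HadamardVertex n} (h : v ≠ w) (h' : w ≠ antipode v) :
    odd n v w = 0 := by
  have key : ∀ a b : Fin n × ℤˣ, a ≠ b → b ≠ (a.1, -a.2) → oddBlock 1 a b = 0 := by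
    rintro ⟨i, ε⟩ ⟨j, δ⟩ hab hab'
    have : i ≠ j := by
      rintro rfl
      rcases Int.units_eq_one_or ε with rfl | rfl <;>
      rcases Int.units_eq_one_or δ with rfl | rfl <;> simp_all
    simp [oddBlock, this]
  rcases v with v | v <;> rcases w with w | w
  · simpa [odd] using key v w (fun e => h (congrArg _ e)) fun e => h' (congrArg _ e)
  · simp [odd]
  · simp [odd]
  · simpa [odd] using key v w (fun e => h (congrArg _ e)) fun e => h' (congrArg _ e)

/-- Two points of the ball are at distance at most two and hence not antipodal, so only the diagonal
entries of `odd` survive. -/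
theorem odd_apply_of_mem_distBall (hH : H.IsHadamard) {x v w : HadamardVertex n}
    (hv : v ∈ distBall (hadamardGraph H) x 1) (hw : w ∈ distBall (hadamardGraph H) x 1) :
    odd n v w = if v = w then 2⁻¹ else 0 := by
  split_ifs with h
  · rw [h, odd_apply_self]
  · refine odd_apply_of_ne h ?_
    rintro rfl
    have hv2 := (edist_le_two_iff hH v (antipode v)).not.2 (by simp)
    apply hv2
    rw [mem_distBall] at hv hw
    calc (hadamardGraph H).edist v (antipode v)
        ≤ (hadamardGraph H).edist v x + (hadamardGraph H).edist x (antipode v) :=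
          SimpleGraph.edist_triangle
      _ ≤ (1 : ℕ) + (1 : ℕ) := add_le_add (by rwa [SimpleGraph.edist_comm]) hw
      _ = (2 : ℕ) := by norm_num

/-- The neighbours of `x` all lie in one part, so only the row and the column of the centre are
nonzero. -/
theorem oddAdj_apply_of_mem_distBall {x v w : HadamardVertex n}
    (hv : v ∈ distBall (hadamardGraph H) x 1) (hw : w ∈ distBall (hadamardGraph H) x 1) :
    oddAdj H v w = (if v = x then oddAdj H x w else 0) + (if w = x then oddAdj H v x else 0) := by
  rw [mem_distBall_one] at hv hw
  by_cases hvx : v = x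
  · subst hvx
    by_cases hwv : w = v
    · simp [hwv, oddAdj_apply_of_isLeft_eq]
    · simp [hwv]
  · by_cases hwx : w = x
    · simp [hvx, hwx]
    · have h1 := isLeft_ne_of_adj (hv.resolve_left hvx)
      have h2 := isLeft_ne_of_adj (hw.resolve_left hwx)
      rw [oddAdj_apply_of_isLeft_eq, if_neg hvx, if_neg hwx, add_zero]
      revert h1 h2
      cases v.isLeft <;> cases w.isLeft <;> cases x.isLeft <;> simp

/-! ### Projections onto the filled levels -/

theorem isProjectionMatrix_sum (hH : H.IsHadamard) (hn : 2 ≤ n) (K : ℕ) :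
    IsProjectionMatrix (∑ i ∈ Finset.univ.filter fun i : Fin 5 => (i : ℕ) ≤ K,
      spectralProjection H i) (filledModes (hadamardGraph H) K) := by
  have hn0 : n ≠ 0 := by omega
  have hn0' : (n : ℂ) ≠ 0 := by exact_mod_cast hn0
  refine isProjectionMatrix_filledModes _ (level n) (level_strictAnti hn) _
    (spectralProjection_isHermitian H) (fun i hi => ?_) (sum_spectralProjection H)
    (adjMatrix_mul_spectralProjection hH hn0) K
  have h := congrFun (congrFun hi (Sum.inl (⟨0, by omega⟩, 1))) (Sum.inl (⟨0, by omega⟩, 1))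
  fin_cases i <;> simp [spectralProjection, ones_apply, odd_apply_self,
    partSigns_apply_self, oddAdj_apply_self, hn0] at h
  -- Only the eigenvalue zero is left: its projection has diagonal entry `1/2 - 1/(2n)`, which
  -- vanishes only for `n = 1`.
  have h' : (n : ℂ) = 1 := by
    field_simp at h
    linear_combination h / 4
  have : n = 1 := by exact_mod_cast h'
  omega

theorem isProjectionMatrix_one (hH : H.IsHadamard) (hn : 2 ≤ n) :
    IsProjectionMatrix ((4 * n : ℂ)⁻¹ • ones n +
      ((2⁻¹ : ℂ) • odd n + (2 * (√n : ℝ) : ℂ)⁻¹ • oddAdj H))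
      (filledModes (hadamardGraph H) 1) := by
  have h := isProjectionMatrix_sum hH hn 1
  have e : (Finset.univ.filter fun i : Fin 5 => (i : ℕ) ≤ 1) = {0, 1} := by decide
  rw [e, Finset.sum_pair (by decide)] at h
  exact h

/-- Subtracting the empty levels from the identity avoids the projection for the eigenvalue zero. -/
theorem isProjectionMatrix_two (hH : H.IsHadamard) (hn : 2 ≤ n) :
    IsProjectionMatrix (1 - ((4 * n : ℂ)⁻¹ • partSigns n +
      ((2⁻¹ : ℂ) • odd n - (2 * (√n : ℝ) : ℂ)⁻¹ • oddAdj H)))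
      (filledModes (hadamardGraph H) 2) := by
  have h := isProjectionMatrix_sum hH hn 2
  have e : (Finset.univ.filter fun i : Fin 5 => (i : ℕ) ≤ 2) = {3, 4}ᶜ := by decide
  rw [e, eq_sub_of_add_eq (Finset.sum_compl_add_sum {3, 4} (spectralProjection H)),
    sum_spectralProjection,
    Finset.sum_pair (by decide), add_comm] at h
  exact h

theorem isProjectionMatrix_three (hH : H.IsHadamard) (hn : 2 ≤ n) :
    IsProjectionMatrix (1 - (4 * n : ℂ)⁻¹ • partSigns n) (filledModes (hadamardGraph H) 3) := by
  have h := isProjectionMatrix_sum hH hn 3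
  have e : (Finset.univ.filter fun i : Fin 5 => (i : ℕ) ≤ 3) = {4}ᶜ := by decide
  rw [e, eq_sub_of_add_eq (Finset.sum_compl_add_sum {4} (spectralProjection H)),
    sum_spectralProjection,
    Finset.sum_singleton] at h
  exact h

/-! ### Exact entropies for radius three, and bounds for radii one and two -/

theorem hadamardEntropy_three_eq (hH : H.IsHadamard) (hn : 2 ≤ n) (x : HadamardVertex n) {K : ℕ}
    {P : Matrix (HadamardVertex n) (HadamardVertex n) ℂ}
    (hP : IsProjectionMatrix P (filledModes (hadamardGraph H) K)) {p : ℝ}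
    (hp : P (antipode x) (antipode x) = p) : hadamardEntropy H x K 3 = Real.binEntropy p :=
  vonNeumannEntropy_eq_binEntropy hP (compl_distBall_three hH hn x) hp

theorem hadamardEntropy_one_three (hH : H.IsHadamard) (hn : 2 ≤ n) (x : HadamardVertex n) :
    hadamardEntropy H x 1 3 = Real.binEntropy (1 / 4 + 1 / (4 * n)) := by
  refine hadamardEntropy_three_eq hH hn x (isProjectionMatrix_one hH hn) ?_
  simp [ones_apply, odd_apply_self, oddAdj_apply_self]
  ring

theorem hadamardEntropy_two_three (hH : H.IsHadamard) (hn : 2 ≤ n) (x : HadamardVertex n) :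
    hadamardEntropy H x 2 3 = Real.binEntropy (1 / 4 + 1 / (4 * n)) := by
  rw [← Real.binEntropy_one_sub]
  refine hadamardEntropy_three_eq hH hn x (isProjectionMatrix_two hH hn) ?_
  simp [partSigns_apply_self, odd_apply_self, oddAdj_apply_self]
  ring

theorem hadamardEntropy_three_three (hH : H.IsHadamard) (hn : 2 ≤ n) (x : HadamardVertex n) :
    hadamardEntropy H x 3 3 = Real.binEntropy (1 / (4 * n)) := by
  rw [← Real.binEntropy_one_sub]
  refine hadamardEntropy_three_eq hH hn x (isProjectionMatrix_three hH hn) ?_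
  simp [partSigns_apply_self]

theorem abs_hadamardEntropy_sub_le (hH : H.IsHadamard) {x y : HadamardVertex n} {K l : ℕ}
    (hy : distBall (hadamardGraph H) y 1 = distBall (hadamardGraph H) x l ∨
      distBall (hadamardGraph H) y 1 = (distBall (hadamardGraph H) x l)ᶜ)
    {P : Matrix (HadamardVertex n) (HadamardVertex n) ℂ}
    (hP : IsProjectionMatrix P (filledModes (hadamardGraph H) K)) {c : ℝ}
    (hc : c ∈ Set.Icc (0 : ℝ) 1) (α β : ℂ) (u : HadamardVertex n → ℂ)
    (hPu : ∀ v ∈ distBall (hadamardGraph H) y 1, ∀ w ∈ distBall (hadamardGraph H) y 1,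
      P v w = (if v = w then (c : ℂ) else 0) + α * (u v * u w) + β * oddAdj H v w) :
    |hadamardEntropy H x K l - (n + 1) * Real.binEntropy c| ≤ 3 * Real.log 2 := by
  have h := abs_vonNeumannEntropy_sub_le hP hy hc (r := 3) ?_
  · rw [card_distBall_one hH] at h
    exact_mod_cast h
  -- Three rank-one terms: the one from `u`, the row of `oddAdj H` at the centre, and its column
  -- there.
  · refine Matrix.rank_le_of_eq_sum _
      ![fun v => α * u v, fun v => if v.1 = y then β else 0, fun v => β * oddAdj H v y]
      ![fun v => u v, fun v => oddAdj H y v, fun v => if v.1 = y then 1 else 0] ?_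
    rintro ⟨v, hv⟩ ⟨w, hw⟩
    rw [Matrix.sub_apply, Matrix.submatrix_apply, hPu v hv w hw,
      oddAdj_apply_of_mem_distBall hv hw, Fin.sum_univ_three, Matrix.smul_apply,
      Matrix.one_apply]
    simp only [Subtype.mk.injEq, Matrix.cons_val]
    split_ifs <;> simp <;> ring

theorem abs_hadamardEntropy_one_one_sub_le (hH : H.IsHadamard) (hn : 2 ≤ n)
    (x : HadamardVertex n) :
    |hadamardEntropy H x 1 1 - (n + 1) * Real.binEntropy (1 / 4)| ≤ 3 * Real.log 2 := by
  refine abs_hadamardEntropy_sub_le hH (y := x) (Or.inl rfl) (isProjectionMatrix_one hH hn)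
    (by norm_num) (4 * n : ℂ)⁻¹ (2 * (√n : ℝ) : ℂ)⁻¹ (fun _ => 1) fun v hv w hw => ?_
  rw [Matrix.add_apply, Matrix.add_apply, Matrix.smul_apply, Matrix.smul_apply, Matrix.smul_apply,
    ones_apply, odd_apply_of_mem_distBall hH hv hw]
  simp only [smul_eq_mul]
  push_cast
  split_ifs <;> ring

theorem abs_hadamardEntropy_one_two_sub_le (hH : H.IsHadamard) (hn : 2 ≤ n)
    (x : HadamardVertex n) :
    |hadamardEntropy H x 1 2 - (n + 1) * Real.binEntropy (1 / 4)| ≤ 3 * Real.log 2 := by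
  refine abs_hadamardEntropy_sub_le hH (y := antipode x) (Or.inr (compl_distBall_two hH x).symm)
    (isProjectionMatrix_one hH hn)
    (by norm_num) (4 * n : ℂ)⁻¹ (2 * (√n : ℝ) : ℂ)⁻¹ (fun _ => 1) fun v hv w hw => ?_
  rw [Matrix.add_apply, Matrix.add_apply, Matrix.smul_apply, Matrix.smul_apply, Matrix.smul_apply,
    ones_apply, odd_apply_of_mem_distBall hH hv hw]
  simp only [smul_eq_mul]
  push_cast
  split_ifs <;> ring

theorem abs_hadamardEntropy_two_two_sub_le (hH : H.IsHadamard) (hn : 2 ≤ n)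
    (x : HadamardVertex n) :
    |hadamardEntropy H x 2 2 - (n + 1) * Real.binEntropy (1 / 4)| ≤ 3 * Real.log 2 := by
  -- Here the diagonal constant is `1 - 1/4`, since `P` is the identity minus the empty levels.
  rw [← Real.binEntropy_one_sub]
  refine abs_hadamardEntropy_sub_le hH (y := antipode x) (Or.inr (compl_distBall_two hH x).symm)
    (isProjectionMatrix_two hH hn)
    (by norm_num) (-(4 * n : ℂ)⁻¹) (2 * (√n : ℝ) : ℂ)⁻¹ (fun v => if v.isLeft then 1 else -1)
    fun v hv w hw => ?_
  rw [Matrix.sub_apply, Matrix.add_apply, Matrix.sub_apply, Matrix.smul_apply, Matrix.smul_apply,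
    Matrix.smul_apply, partSigns_apply, odd_apply_of_mem_distBall hH hv hw, Matrix.one_apply]
  simp only [smul_eq_mul]
  push_cast
  by_cases h : v = w
  · rw [if_pos h, if_pos h, if_pos h]; ring
  · rw [if_neg h, if_neg h, if_neg h]; ring

end HadamardGraph

/-! ### Asymptotics -/

theorem binEntropy_quarter : Real.binEntropy (1 / 4) = 2 * Real.log 2 - 3 / 4 * Real.log 3 := by
  have h4 : Real.log 4 = 2 * Real.log 2 := by
    rw [show (4 : ℝ) = 2 ^ 2 by norm_num, Real.log_pow]; norm_num
  rw [Real.binEntropy, show (1 / 4 : ℝ)⁻¹ = 4 by norm_num,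
    show (1 - 1 / 4 : ℝ)⁻¹ = 4 / 3 by norm_num, Real.log_div (by norm_num) (by norm_num), h4]
  ring

theorem isEquivalent_of_abs_sub_le {n : ℕ → ℕ} (hn : Tendsto n atTop atTop) {f : ℕ → ℝ}
    {a C : ℝ} (ha : a ≠ 0) (hf : ∀ᶠ m in atTop, |f m - (n m + 1) * a| ≤ C) :
    f ~[atTop] fun m => a * (n m : ℝ) := by
  have h1 : (f - fun m => a * (n m : ℝ)) =O[atTop] fun _ => (1 : ℝ) := by
    refine IsBigO.of_bound (C + |a|) ?_
    filter_upwards [hf] with m hm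
    rw [Real.norm_eq_abs, norm_one, mul_one, Pi.sub_apply]
    calc |f m - a * n m| = |(f m - (n m + 1) * a) + a| := by ring_nf
      _ ≤ |f m - (n m + 1) * a| + |a| := abs_add_le _ _
      _ ≤ C + |a| := by gcongr
  have h2 : (fun _ => (1 : ℝ)) =o[atTop] fun m => (n m : ℝ) := by
    rw [isLittleO_const_left]
    exact Or.inr (tendsto_norm_atTop_atTop.comp (tendsto_natCast_atTop_atTop.comp hn))
  exact h1.trans_isLittleO (h2.const_mul_right ha)

theorem isEquivalent_binEntropy_one_div {n : ℕ → ℕ} (hn : Tendsto n atTop atTop) :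
    (fun m => Real.binEntropy (1 / (4 * n m))) ~[atTop]
      fun m => Real.log (n m) / (4 * (n m : ℝ)) := by
  have hlog : Tendsto (fun m => Real.log (n m)) atTop atTop :=
    Real.tendsto_log_atTop.comp (tendsto_natCast_atTop_atTop.comp hn)
  have h1 : ((fun m => Real.binEntropy (1 / (4 * n m))) -
      fun m => Real.log (n m) / (4 * (n m : ℝ))) =O[atTop] fun m => 1 / (4 * (n m : ℝ)) := by
    refine IsBigO.of_bound (Real.log 4 + 1) ?_
    filter_upwards [hn.eventually_ge_atTop 1] with m hm
    have hm1 : (1 : ℝ) ≤ n m := by exact_mod_cast hm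
    have hpos : (0 : ℝ) < n m := by linarith
    set p : ℝ := 1 / (4 * n m) with hp
    have hp0 : 0 < p := by positivity
    have hp1 : p < 1 := by
      rw [hp, div_lt_one (by positivity)]
      linarith
    have hq : 0 < 1 - p := by linarith
    have e1 : Real.log p⁻¹ = Real.log 4 + Real.log (n m) := by
      rw [hp, one_div, inv_inv, Real.log_mul (by norm_num) hpos.ne']
    have e2 : Real.log (n m) / (4 * (n m : ℝ)) = p * Real.log (n m) := by
      rw [hp]; ring
    have hlog4 : 0 ≤ Real.log 4 := Real.log_nonneg (by norm_num)
    have u1 : 0 ≤ Real.log (1 - p)⁻¹ :=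
      Real.log_nonneg ((one_le_inv₀ hq).2 (by linarith))
    -- From `log t ≤ t - 1`. With the term `p * log 4`, it bounds the error by `(log 4 + 1) * p`,
    -- which is negligible against `p * log n`.
    have u2 : (1 - p) * Real.log (1 - p)⁻¹ ≤ p := by
      have := Real.log_le_sub_one_of_pos (inv_pos.2 hq)
      calc (1 - p) * Real.log (1 - p)⁻¹ ≤ (1 - p) * ((1 - p)⁻¹ - 1) := by gcongr
        _ = p := by field_simp; ring
    rw [Pi.sub_apply, e2, Real.binEntropy, e1, Real.norm_eq_abs, Real.norm_eq_abs,
      abs_of_pos hp0, abs_of_nonneg]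
    · nlinarith
    · have := mul_nonneg hq.le u1
      have := mul_nonneg hp0.le hlog4
      nlinarith
  have h2 : (fun m => 1 / (4 * (n m : ℝ))) =o[atTop]
      fun m => Real.log (n m) / (4 * (n m : ℝ)) := by
    have h3 : (fun _ => (1 : ℝ)) =o[atTop] fun m => Real.log (n m) := by
      rw [isLittleO_const_left]
      exact Or.inr (tendsto_norm_atTop_atTop.comp hlog)
    have := (isBigO_refl (fun m => 1 / (4 * (n m : ℝ))) atTop).mul_isLittleO h3
    refine (this.congr (fun m => by ring) fun m => by ring)
  exact h1.trans_isLittleO h2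

open HadamardGraph in
theorem mainTheorem6
    (n : ℕ → ℕ) (hn : Tendsto n atTop atTop)
    (H : ∀ m, Matrix (Fin (n m)) (Fin (n m)) ℤ) (hH : ∀ m, (H m).IsHadamard)
    (x : ∀ m, HadamardVertex (n m)) :
    -- `S_{2,3} ∼ S_{1,3} → 2 log 2 - (3/4) log 3`
    ((fun m => hadamardEntropy (H m) (x m) 2 3) ~[atTop]
        (fun m => hadamardEntropy (H m) (x m) 1 3) ∧
      Tendsto (fun m => hadamardEntropy (H m) (x m) 1 3) atTop
        (𝓝 (2 * Real.log 2 - 3 / 4 * Real.log 3)) ∧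
      Tendsto (fun m => hadamardEntropy (H m) (x m) 2 3) atTop
        (𝓝 (2 * Real.log 2 - 3 / 4 * Real.log 3))) ∧
    -- `S_{3,3} ∼ log n / (4 n)`
    ((fun m => hadamardEntropy (H m) (x m) 3 3) ~[atTop]
        (fun m => Real.log (n m) / (4 * (n m : ℝ)))) ∧
    -- `S_{1,1} ∼ S_{1,2} ∼ S_{2,2} ∼ (2 log 2 - (3/4) log 3) n`
    ((fun m => hadamardEntropy (H m) (x m) 1 1) ~[atTop]
        (fun m => hadamardEntropy (H m) (x m) 1 2) ∧
      (fun m => hadamardEntropy (H m) (x m) 1 2) ~[atTop]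
        (fun m => hadamardEntropy (H m) (x m) 2 2) ∧
      (fun m => hadamardEntropy (H m) (x m) 1 1) ~[atTop]
        (fun m => (2 * Real.log 2 - 3 / 4 * Real.log 3) * (n m : ℝ)) ∧
      (fun m => hadamardEntropy (H m) (x m) 1 2) ~[atTop]
        (fun m => (2 * Real.log 2 - 3 / 4 * Real.log 3) * (n m : ℝ)) ∧
      (fun m => hadamardEntropy (H m) (x m) 2 2) ~[atTop]
        (fun m => (2 * Real.log 2 - 3 / 4 * Real.log 3) * (n m : ℝ))) := by
  -- From `n = 2` on, the five levels are distinct and all occur, so the formulas above apply.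
  have hev := hn.eventually_ge_atTop 2
  have h13 : (fun m => Real.binEntropy (1 / 4 + 1 / (4 * n m))) =ᶠ[atTop]
      fun m => hadamardEntropy (H m) (x m) 1 3 :=
    hev.mono fun m hm => (hadamardEntropy_one_three (hH m) hm (x m)).symm
  have h23 : (fun m => Real.binEntropy (1 / 4 + 1 / (4 * n m))) =ᶠ[atTop]
      fun m => hadamardEntropy (H m) (x m) 2 3 :=
    hev.mono fun m hm => (hadamardEntropy_two_three (hH m) hm (x m)).symm
  have hlim : Tendsto (fun m => Real.binEntropy (1 / 4 + 1 / (4 * n m))) atTop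
      (𝓝 (2 * Real.log 2 - 3 / 4 * Real.log 3)) := by
    rw [← binEntropy_quarter]
    refine (Real.binEntropy_continuous.tendsto _).comp ?_
    have h := ((tendsto_natCast_atTop_atTop (R := ℝ)).comp hn).const_mul_atTop
      (show (0 : ℝ) < 4 by norm_num)
    simpa using (tendsto_inv_atTop_zero.comp h).const_add (1 / 4 : ℝ)
  have ha : (2 * Real.log 2 - 3 / 4 * Real.log 3 : ℝ) ≠ 0 := by
    rw [← binEntropy_quarter]
    exact (Real.binEntropy_pos (by norm_num) (by norm_num)).ne'
  have h11 := isEquivalent_of_abs_sub_le hn ha (hev.mono fun m hm => by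
    rw [← binEntropy_quarter]
    exact abs_hadamardEntropy_one_one_sub_le (hH m) hm (x m))
  have h12 := isEquivalent_of_abs_sub_le hn ha (hev.mono fun m hm => by
    rw [← binEntropy_quarter]
    exact abs_hadamardEntropy_one_two_sub_le (hH m) hm (x m))
  have h22 := isEquivalent_of_abs_sub_le hn ha (hev.mono fun m hm => by
    rw [← binEntropy_quarter]
    exact abs_hadamardEntropy_two_two_sub_le (hH m) hm (x m))
  refine ⟨⟨(h23.symm.trans h13).isEquivalent, hlim.congr' h13, hlim.congr' h23⟩, ?_,
    h11.trans h12.symm, h12.trans h22.symm, h11, h12, h22⟩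
  refine (isEquivalent_binEntropy_one_div hn).congr_left ?_
  exact hev.mono fun m hm => (hadamardEntropy_three_three (hH m) hm (x m)).symm

end
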